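/- Let $\Omega\subset\mathbb{R}^3$ be a bounded domain (non-empty, open, connected), and let $V\in L^\infty(\mathbb{R}^3)$ be real-valued with $\operatorname{supp} V=\overline{\Omega}$ and $V\ge\delta$ a.e. in $\overline{\Omega}$ for some constant $\delta>0$. Let $P_0=\Delta^2$, and let $H^{P_0}_0(\Omega)\subset L^2(\Omega)$ be the completion of $C_0^\infty(\Omega)$ with respect to the norm $\varphi\mapsto\|\Delta^2\varphi\|_{L^2}$. Call $\lambda\in\mathbb{C}$ a transmission eigenvalue if there are complex-valued functions $0\ne v\in L^2_{\mathrm{loc}}(\Omega)$ and $0\ne w\in L^2_{\mathrm{loc}}(\Omega)$ such that $$(\Delta^2-\lambda)v=0\ \text{ in }\Omega,\qquad (\Delta^2-\lambda(1+V))w=0\ \text{ in }\Omega,\qquad v-w\in H^{P_0}_0(\Omega),$$ where the equations are understood in the sense of distributions. Then the set of real transmission eigenvalues is infinite. -/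

import Mathlib

open MeasureTheory Filter Topology
open scoped ContDiff

noncomputable section

namespace Biharmonic

/-- Euclidean three-space. -/
abbrev R3 : Type := EuclideanSpace ℝ (Fin 3)

/-- `φ ∈ C₀^∞(Ω)`, complex-valued. -/
structure IsTestFunction (Ω : Set R3) (φ : R3 → ℂ) : Prop where
  smooth : ContDiff ℝ ∞ φ
  compact : HasCompactSupport φ
  subset : tsupport φ ⊆ Ω

/-- The biharmonic operator `P₀ = Δ²` on (smooth) functions on three-space. -/
def bilaplacian (φ : R3 → ℂ) : R3 → ℂ :=
  (Laplacian.laplacian (Laplacian.laplacian φ : R3 → ℂ) : R3 → ℂ)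

/-- The norm `‖φ‖_{P₀} = ‖Δ² φ‖_{L²}` on test functions. -/
def normP (φ : R3 → ℂ) : ENNReal :=
  eLpNorm (bilaplacian φ) 2 volume

/-- `u ∈ L²_loc(Ω)`. -/
def MemL2Loc (Ω : Set R3) (u : R3 → ℂ) : Prop :=
  ∀ K : Set R3, IsCompact K → K ⊆ Ω → MemLp u 2 (volume.restrict K)

/-- `u` (as a function on `Ω`) belongs to `H₀^{P₀}(Ω)`, the completion of `C₀^∞(Ω)` with respect to
`‖·‖_{P₀}`. Because `‖φ‖ ≤ C ‖φ‖_{P₀}` on `C₀^∞(Ω)` and `P₀` is closable, the completion is the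
space of the `L²(Ω)`-limits of the `‖·‖_{P₀}`-Cauchy sequences of test functions. -/
def MemH0 (Ω : Set R3) (u : R3 → ℂ) : Prop :=
  MemLp u 2 (volume.restrict Ω) ∧
  ∃ φ : ℕ → R3 → ℂ,
    (∀ j, IsTestFunction Ω (φ j)) ∧
    (∀ η : ENNReal, 0 < η → ∃ N : ℕ, ∀ j ≥ N, ∀ k ≥ N, normP (φ j - φ k) < η) ∧
    Tendsto (fun j => eLpNorm (φ j - u) 2 (volume.restrict Ω)) atTop (𝓝 0)

/-- `(P₀ - q) u = 0` in the sense of distributions in `Ω`, where `q` is multiplication by a bounded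
function (`P₀ = Δ²` is its own transpose). -/
def SolvesWeakly (Ω : Set R3) (q : R3 → ℂ) (u : R3 → ℂ) : Prop :=
  ∀ φ : R3 → ℂ, IsTestFunction Ω φ →
    ∫ x in Ω, u x * (bilaplacian φ x - q x * φ x) = 0

/-- `lam` is a transmission eigenvalue of the acoustic-type interior transmission problem for
`P₀ = Δ²` in `Ω` with potential `V`:
`(P₀ - lam) v = 0` and `(P₀ - lam (1 + V)) w = 0` in `Ω`, `v - w ∈ H₀^{P₀}(Ω)`,
with `v, w ∈ L²_loc(Ω)` both non-zero. -/
def IsTransmissionEigenvalue (Ω : Set R3) (V : R3 → ℝ) (lam : ℂ) : Prop :=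
  ∃ v w : R3 → ℂ,
    MemL2Loc Ω v ∧ MemL2Loc Ω w ∧
    ¬ (v =ᵐ[volume.restrict Ω] 0) ∧ ¬ (w =ᵐ[volume.restrict Ω] 0) ∧
    SolvesWeakly Ω (fun _ => lam) v ∧
    SolvesWeakly Ω (fun x => lam * (1 + (V x : ℂ))) w ∧
    MemH0 Ω (v - w)

/-- The support of an almost-everywhere-defined function: the complement of the largest open set on
which it vanishes almost everywhere. -/
def essSupport (V : R3 → ℝ) : Set R3 :=
  {x | ∀ U : Set R3, IsOpen U → x ∈ U → ¬ (V =ᵐ[volume.restrict U] 0)}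

end Biharmonic

end

/-!
For a transmission pair `(v, w)` the difference `h = v - w` satisfies `(P₀ - t) h = -t V w`, so
`(P₀ - t) V⁻¹ (P₀ - t) h + t (P₀ - t) h = 0` weakly on `H₀^{P₀}(Ω)`; conversely a null vector `h` of
this self-adjoint quadratic pencil recovers `w` and `v`, and neither vanishes by unique continuation
(a Carleman estimate with a linear weight). Since `H₀^{P₀}(Ω)` embeds compactly into `L²(Ω)`, the
form of the pencil obeys a Gårding inequality, and its negative index is finite for each `t` and
locally constant as long as the kernel is trivial. The index is unbounded as `t → ∞`: where `P₀`
acts as the number `t (1 + δ / 2)`, the form is `t² (δ / 2) (V⁻¹ δ / 2 - 1) < 0`, and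
modulated amplitudes `exp (i k ⟪x, e⟫) φ` with `k⁴ = t (1 + δ / 2)` realize this approximately in
spaces of any dimension. Hence the kernel is non-trivial for arbitrarily large `t`.
-/

namespace Biharmonic

section CompactOperator

variable {𝕜 H L : Type*} [RCLike 𝕜]
variable [NormedAddCommGroup H] [InnerProductSpace 𝕜 H]
variable [NormedAddCommGroup L] [InnerProductSpace 𝕜 L]

theorem norm_apply_le_of_forall_norm_eq_one {U : H →L[𝕜] L} {F : Submodule 𝕜 H} {ε : ℝ}
    (hU : ∀ u ∈ F, ‖u‖ = 1 → ‖U u‖ ≤ ε) {x : H} (hx : x ∈ F) : ‖U x‖ ≤ ε * ‖x‖ := by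
  rcases eq_or_ne x 0 with rfl | hx0
  · simp
  · have hpos : 0 < ‖x‖ := norm_pos_iff.2 hx0
    have := hU ((‖x‖⁻¹ : 𝕜) • x) (F.smul_mem _ hx) (norm_smul_inv_norm hx0)
    rwa [map_smul, norm_smul, norm_inv, RCLike.norm_ofReal, abs_norm, inv_mul_le_iff₀ hpos,
      mul_comm] at this

variable [CompleteSpace L]

theorem exists_finiteDimensional_norm_le_of_isCompactOperator [CompleteSpace H] {U : H →L[𝕜] L}
    (hU : IsCompactOperator U) {ε : ℝ} (hε : 0 < ε) :
    ∃ F : Submodule 𝕜 H, FiniteDimensional 𝕜 F ∧ ∀ x ∈ Fᗮ, ‖U x‖ ≤ ε * ‖x‖ := by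
  obtain ⟨K, hK, hUK⟩ := hU.image_closedBall_subset_compact (f := (U : H →ₗ[𝕜] L)) 1
  obtain ⟨N, -, hN, hcover⟩ := hK.finite_cover_balls hε
  let F := Submodule.span 𝕜 (U.adjoint '' N)
  refine ⟨F, FiniteDimensional.span_of_finite 𝕜 (hN.image _), fun x hx =>
    norm_apply_le_of_forall_norm_eq_one (fun u hu hu1 => ?_) hx⟩
  obtain ⟨y, hy, huy⟩ : ∃ y ∈ N, U u ∈ Metric.ball y ε := by
    simpa using hcover (hUK ⟨u, by simpa using hu1.le, rfl⟩)
  have horth : inner 𝕜 (U u) y = 0 := by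
    rw [← ContinuousLinearMap.adjoint_inner_right]
    exact Submodule.inner_left_of_mem_orthogonal
      (Submodule.subset_span (Set.mem_image_of_mem _ hy)) hu
  have hsq : ‖U u‖ * ‖U u‖ ≤ ‖U u‖ * ε := by
    calc ‖U u‖ * ‖U u‖ = ‖inner 𝕜 (U u) (U u - y)‖ := by
          simp [inner_sub_right, horth, inner_self_eq_norm_sq_to_K, sq]
      _ ≤ ‖U u‖ * ‖U u - y‖ := norm_inner_le_norm _ _
      _ ≤ ‖U u‖ * ε := by gcongr; exact (mem_ball_iff_norm.1 huy).le
  rcases (norm_nonneg (U u)).eq_or_lt with h | h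
  · exact h ▸ hε.le
  · exact le_of_mul_le_mul_left hsq h

theorem isCompactOperator_of_forall_exists_finiteDimensional {U : H →L[𝕜] L}
    (hU : ∀ ε > 0, ∃ F : Submodule 𝕜 H, FiniteDimensional 𝕜 F ∧ ∀ x ∈ Fᗮ, ‖U x‖ ≤ ε * ‖x‖) :
    IsCompactOperator U := by
  refine (isClosed_setOfPred_isCompactOperator (σ₁₂ := RingHom.id 𝕜)
    (M₁ := H) (M₂ := L)).closure_subset (a := U) (Metric.mem_closure_iff.2 fun ε hε => ?_)
  obtain ⟨F, hF, hFU⟩ := hU (ε / 2) (by positivity)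
  refine ⟨U ∘L F.starProjection, ?_, ?_⟩
  · have : ProperSpace F := FiniteDimensional.proper 𝕜 F
    exact (isCompactOperator_of_locallyCompactSpace_dom F.orthogonalProjectionOnto).clm_comp
      (U ∘L F.subtypeL)
  · rw [dist_eq_norm]
    refine (ContinuousLinearMap.opNorm_le_bound _ (by positivity) fun x => ?_).trans_lt
      (half_lt_self hε)
    calc ‖(U - U ∘L F.starProjection) x‖ = ‖U (x - F.starProjection x)‖ := by simp
      _ ≤ ε / 2 * ‖x - F.starProjection x‖ :=
        hFU _ (F.sub_starProjection_mem_orthogonal x)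
      _ ≤ ε / 2 * ‖x‖ := by
        gcongr
        rw [← Submodule.starProjection_orthogonal_val]
        exact Fᗮ.norm_starProjection_apply_le x

end CompactOperator

theorem isUnit_sub_of_isCompactOperator {𝕜 E : Type*} [NontriviallyNormedField 𝕜]
    [NormedAddCommGroup E] [NormedSpace 𝕜 E] [CompleteSpace E] {A K : E →L[𝕜] E} (hA : IsUnit A)
    (hK : IsCompactOperator K) (hker : ∀ x, A x = K x → x = 0) : IsUnit (A - K) := by
  obtain ⟨A, rfl⟩ := hA
  have hcompact : IsCompactOperator (↑A⁻¹ * K : E →L[𝕜] E) := hK.clm_comp (↑A⁻¹ : E →L[𝕜] E)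
  have hfactor : (A : E →L[𝕜] E) - K = A * (1 - ↑A⁻¹ * K) := by
    rw [mul_sub, ← mul_assoc, A.mul_inv, mul_one, one_mul]
  rw [hfactor]
  refine A.isUnit.mul ?_
  rcases hcompact.hasEigenvalue_or_mem_resolventSet (μ := 1) one_ne_zero with h | h
  · obtain ⟨x, hx, hx0⟩ := h.exists_hasEigenvector
    have hx1 : (↑A⁻¹ * K : E →L[𝕜] E) x = x := by
      simpa using Module.End.mem_eigenspace_iff.1 hx
    refine absurd (hker x ?_) hx0
    have hAx := congrArg (A : E →L[𝕜] E) hx1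
    rwa [← mul_apply_eq_comp, ← mul_assoc, A.mul_inv, one_mul, eq_comm] at hAx
  · simpa [spectrum.mem_resolventSet_iff] using h

section Garding

variable {H L : Type*} [NormedAddCommGroup H] [InnerProductSpace ℂ H]
variable [NormedAddCommGroup L] [InnerProductSpace ℂ L]

/-- The quadratic form of `S` is negative definite on a `k`-dimensional space, presented as the
range of a linear map from `ℂᵏ` (necessarily injective). -/
def NegIndexGE (k : ℕ) (S : H →L[ℂ] H) : Prop :=
  ∃ ℓ : (Fin k → ℂ) →ₗ[ℂ] H, ∀ c, c ≠ 0 → (inner ℂ (S (ℓ c)) (ℓ c)).re < 0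

/-- A Gårding inequality: the quadratic form of `S` is coercive up to a multiple of `‖U ·‖²`, where
in the applications `U` is compact. -/
def SatisfiesGarding (U : H →L[ℂ] L) (S : H →L[ℂ] H) : Prop :=
  ∃ c > 0, ∃ C : ℝ, ∀ x, c * ‖x‖ ^ 2 ≤ (inner ℂ (S x) x).re + C * ‖U x‖ ^ 2

variable [CompleteSpace H] [CompleteSpace L] {U : H →L[ℂ] L} {S : H →L[ℂ] H}

theorem SatisfiesGarding.exists_not_negIndexGE (hS : SatisfiesGarding U S)
    (hU : IsCompactOperator U) : ∃ k, ¬ NegIndexGE k S := by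
  obtain ⟨c, hc, C, hS⟩ := hS
  obtain ⟨ε, hε, hεC⟩ : ∃ ε > 0, |C| * ε ^ 2 ≤ c := by
    refine ⟨√(c / (|C| + 1)), by positivity, ?_⟩
    rw [Real.sq_sqrt (by positivity), mul_div_assoc', div_le_iff₀ (by positivity)]
    nlinarith [abs_nonneg C]
  obtain ⟨F, hF, hFU⟩ := exists_finiteDimensional_norm_le_of_isCompactOperator hU hε
  refine ⟨Module.finrank ℂ F + 1, ?_⟩
  rintro ⟨ℓ, hℓ⟩
  obtain ⟨v, hv0, hv⟩ : ∃ v ≠ 0, ℓ v ∈ Fᗮ := by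
    have hker : ((F.orthogonalProjectionOnto : H →ₗ[ℂ] F) ∘ₗ ℓ).ker ≠ ⊥ :=
      LinearMap.ker_ne_bot_of_finrank_lt (by simp)
    obtain ⟨v, hv, hv0⟩ := (Submodule.ne_bot_iff _).1 hker
    exact ⟨v, hv0, by rw [← F.ker_orthogonalProjectionOnto]; simpa using hv⟩
  have hcoercive : c * ‖ℓ v‖ ^ 2 ≤ (inner ℂ (S (ℓ v)) (ℓ v)).re + c * ‖ℓ v‖ ^ 2 :=
    calc c * ‖ℓ v‖ ^ 2 ≤ (inner ℂ (S (ℓ v)) (ℓ v)).re + C * ‖U (ℓ v)‖ ^ 2 := hS _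
      _ ≤ (inner ℂ (S (ℓ v)) (ℓ v)).re + |C| * (ε * ‖ℓ v‖) ^ 2 := by
        gcongr
        exacts [le_abs_self C, hFU _ hv]
      _ = (inner ℂ (S (ℓ v)) (ℓ v)).re + |C| * ε ^ 2 * ‖ℓ v‖ ^ 2 := by ring
      _ ≤ _ := by gcongr
  linarith [hℓ v hv0]

theorem SatisfiesGarding.isUnit (hS : SatisfiesGarding U S) (hU : IsCompactOperator U)
    (hker : ∀ x, S x = 0 → x = 0) : IsUnit S := by
  obtain ⟨c, hc, C, hS⟩ := hS
  let K : H →L[ℂ] H := (C : ℂ) • (U.adjoint ∘L U)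
  have hK : IsCompactOperator K := (hU.clm_comp U.adjoint).smul (C : ℂ)
  have hform (x : H) : (inner ℂ ((S + K) x) x).re = (inner ℂ (S x) x).re + C * ‖U x‖ ^ 2 := by
    have hKx : inner ℂ (K x) x = ((C * ‖U x‖ ^ 2 : ℝ) : ℂ) := by
      simp [K, ContinuousLinearMap.adjoint_inner_left, inner_self_eq_norm_sq_to_K]
    rw [add_apply, inner_add_left, Complex.add_re, hKx, Complex.ofReal_re]
  have hA : IsUnit (S + K) :=
    ContinuousLinearMap.isUnit_of_forall_le_norm_inner_map (c := ⟨c, hc.le⟩) _ hc fun x => by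
      calc ‖x‖ ^ 2 * c ≤ (inner ℂ ((S + K) x) x).re := by rw [hform, mul_comm]; exact hS x
        _ ≤ ‖inner ℂ ((S + K) x) x‖ := Complex.re_le_norm _
  simpa using isUnit_sub_of_isCompactOperator hA hK fun x hx => hker x (by simpa using hx)

end Garding

section DefiniteSplitting

theorem exists_pos_forall_le_abs_of_mem_spectrum {A : Type*} [NormedRing A] [NormedAlgebra ℝ A]
    [CompleteSpace A] {a : A} (ha : IsUnit a) : ∃ c > 0, ∀ x ∈ spectrum ℝ a, c ≤ |x| := by
  obtain ⟨c, hc, hball⟩ := Metric.isOpen_iff.1 (spectrum.isClosed (𝕜 := ℝ) a).isOpen_compl 0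
    (spectrum.zero_notMem ℝ ha)
  refine ⟨c, hc, fun x hx => ?_⟩
  by_contra! hlt
  exact hball (by simpa using hlt) hx

theorem exists_isIdempotentElem_le_of_isUnit {A : Type*} [CStarAlgebra A] [PartialOrder A]
    [StarOrderedRing A] {a : A} (hsa : IsSelfAdjoint a) (hu : IsUnit a) :
    ∃ c : ℝ, 0 < c ∧ ∃ p : A, IsIdempotentElem p ∧
      c • (1 - p) ≤ a - a * p ∧ a * p ≤ -(c • p) := by
  obtain ⟨c, hc, hgap⟩ := exists_pos_forall_le_abs_of_mem_spectrum hu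
  -- a continuous function which on the spectrum is the indicator of the negative half-line
  obtain ⟨q, hq, hq_spec⟩ : ∃ q : ℝ → ℝ, Continuous q ∧
      ∀ x ∈ spectrum ℝ a, (x ≤ -c ∧ q x = 1) ∨ (c ≤ x ∧ q x = 0) := by
    refine ⟨fun x => max 0 (min 1 (-x / c)), by fun_prop, fun x hx => ?_⟩
    rcases le_abs.1 (hgap x hx) with h | h
    · refine .inr ⟨h, max_eq_left (min_le_of_right_le ?_)⟩
      exact div_nonpos_of_nonpos_of_nonneg (by linarith) hc.le
    · refine .inl ⟨by linarith, ?_⟩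
      simp only [min_eq_left ((one_le_div hc).2 h), zero_le_one, max_eq_right]
  have hap : cfc (fun x => x * q x) a = a * cfc q a := by rw [cfc_mul (fun x => x) q a, cfc_id' ℝ a]
  have hcp : cfc (fun x => c * q x) a = c • cfc q a := cfc_const_mul c q a
  refine ⟨c, hc, cfc q a, ?_, ?_, ?_⟩
  · rw [IsIdempotentElem, ← cfc_mul q q a]
    refine cfc_congr fun x hx => ?_
    rcases hq_spec x hx with ⟨-, h⟩ | ⟨-, h⟩ <;> simp [h]
  · calc c • (1 - cfc q a) = cfc (fun x => c - c * q x) a := by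
          rw [cfc_sub (fun _ => c) (fun x => c * q x) a, hcp, cfc_const c a, smul_sub,
            Algebra.algebraMap_eq_smul_one]
      _ ≤ cfc (fun x => x - x * q x) a := by
          refine cfc_mono fun x hx => ?_
          rcases hq_spec x hx with ⟨-, h⟩ | ⟨hx, h⟩ <;> simp [*]
      _ = a - a * cfc q a := by
          rw [cfc_sub (fun x => x) (fun x => x * q x) a, cfc_id' ℝ a, hap]
  · rw [← hap, ← hcp, ← cfc_neg (fun x => c * q x) a]
    refine cfc_mono fun x hx => ?_
    rcases hq_spec x hx with ⟨hx, h⟩ | ⟨-, h⟩ <;> simp [*]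

variable {H : Type*} [NormedAddCommGroup H] [InnerProductSpace ℂ H]

theorem re_inner_le_re_inner_of_le {S T : H →L[ℂ] H} (h : S ≤ T) (x : H) :
    (inner ℂ (S x) x).re ≤ (inner ℂ (T x) x).re := by
  have := ((ContinuousLinearMap.le_def _ _).1 h).re_inner_nonneg_left x
  rwa [sub_apply, inner_sub_left, map_sub, sub_nonneg] at this

theorem abs_re_inner_sub_re_inner_lt {S T : H →L[ℂ] H} {c : ℝ} (hST : ‖S - T‖ < c) {x : H}
    (hx : x ≠ 0) : |(inner ℂ (S x) x).re - (inner ℂ (T x) x).re| < c * ‖x‖ ^ 2 := by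
  have := norm_pos_iff.2 hx
  calc |(inner ℂ (S x) x).re - (inner ℂ (T x) x).re| = |(inner ℂ ((S - T) x) x).re| := by
        rw [sub_apply, inner_sub_left, Complex.sub_re]
    _ ≤ ‖inner ℂ ((S - T) x) x‖ := Complex.abs_re_le_norm _
    _ ≤ ‖(S - T) x‖ * ‖x‖ := norm_inner_le_norm _ _
    _ ≤ ‖S - T‖ * ‖x‖ * ‖x‖ := by gcongr; exact ContinuousLinearMap.le_opNorm _ _
    _ < c * ‖x‖ * ‖x‖ := by gcongr
    _ = c * ‖x‖ ^ 2 := by ring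

variable [CompleteSpace H]

theorem exists_definite_splitting {T : H →L[ℂ] H} (hT : IsSelfAdjoint T) (hu : IsUnit T) :
    ∃ c > 0, ∃ Q : H →L[ℂ] H, (∀ x, Q (Q x) = Q x) ∧
      (∀ x, Q x = 0 → c * ‖x‖ ^ 2 ≤ (inner ℂ (T x) x).re) ∧
      (∀ x, Q x = x → (inner ℂ (T x) x).re ≤ -(c * ‖x‖ ^ 2)) := by
  obtain ⟨c, hc, Q, hQ, hpos, hneg⟩ := exists_isIdempotentElem_le_of_isUnit hT hu
  refine ⟨c, hc, Q, fun x => congr($hQ x), fun x hx => ?_, fun x hx => ?_⟩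
  · simpa [hx, ← Complex.ofReal_pow] using re_inner_le_re_inner_of_le hpos x
  · simpa [hx, ← Complex.coe_smul, inner_smul_left, ← Complex.ofReal_pow] using
      re_inner_le_re_inner_of_le hneg x

theorem eventually_negIndexGE_iff {T : H →L[ℂ] H} (hT : IsSelfAdjoint T) (hu : IsUnit T) :
    ∀ᶠ S in 𝓝 T, ∀ k, NegIndexGE k S ↔ NegIndexGE k T := by
  obtain ⟨c, hc, Q, hQ, hpos, hneg⟩ := exists_definite_splitting hT hu
  -- near `T`, composing with `Q` carries negative spaces of one operator to those of another
  have htransfer (S S' : H →L[ℂ] H) (hS : ‖S - T‖ < c) (hS' : ‖S' - T‖ < c) (k : ℕ) :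
      NegIndexGE k S → NegIndexGE k S' := by
    rintro ⟨ℓ, hℓ⟩
    refine ⟨(Q : H →ₗ[ℂ] H) ∘ₗ ℓ, fun v hv => ?_⟩
    have hℓv : ℓ v ≠ 0 := fun h => by simpa [h] using hℓ v hv
    have hQℓv : Q (ℓ v) ≠ 0 := fun h => by
      linarith [hpos _ h, (abs_lt.1 (abs_re_inner_sub_re_inner_lt hS hℓv)).1, hℓ v hv]
    simp only [LinearMap.comp_apply, ContinuousLinearMap.coe_coe]
    linarith [hneg _ (hQ (ℓ v)), (abs_lt.1 (abs_re_inner_sub_re_inner_lt hS' hQℓv)).2]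
  filter_upwards [Metric.ball_mem_nhds T hc] with S hS k
  have hS : ‖S - T‖ < c := mem_ball_iff_norm.1 hS
  have hT : ‖T - T‖ < c := by simpa using hc
  exact ⟨htransfer S T hS hT k, htransfer T S hT hS k⟩

theorem negIndexGE_iff_of_isPreconnected {X : Type*} [TopologicalSpace X] {s : Set X}
    (hs : IsPreconnected s) {T : X → H →L[ℂ] H} (hcont : ContinuousOn T s)
    (hsa : ∀ t ∈ s, IsSelfAdjoint (T t)) (hu : ∀ t ∈ s, IsUnit (T t)) {t t' : X} (ht : t ∈ s)
    (ht' : t' ∈ s) (k : ℕ) : NegIndexGE k (T t) ↔ NegIndexGE k (T t') := by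
  have hconst : IsLocallyConstant fun r : s => NegIndexGE k (T r) := by
    refine (IsLocallyConstant.iff_eventually_eq _).2 fun r => ?_
    filter_upwards [hcont.domRestrict.continuousAt.eventually
      (eventually_negIndexGE_iff (hsa r r.2) (hu r r.2))] with r' hr'
    exact propext (hr' k)
  have : PreconnectedSpace s := Subtype.preconnectedSpace hs
  exact (hconst.apply_eq_of_preconnectedSpace ⟨t, ht⟩ ⟨t', ht'⟩).to_iff

theorem exists_ge_apply_eq_zero {L : Type*} [NormedAddCommGroup L] [InnerProductSpace ℂ L]
    [CompleteSpace L] {U : H →L[ℂ] L} (hU : IsCompactOperator U) {T : ℝ → H →L[ℂ] H} {t₀ : ℝ}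
    (hcont : ContinuousOn T (Set.Ici t₀)) (hsa : ∀ t ≥ t₀, IsSelfAdjoint (T t))
    (hgard : ∀ t ≥ t₀, SatisfiesGarding U (T t)) (hneg : ∀ k, ∃ t ≥ t₀, NegIndexGE k (T t)) :
    ∃ t ≥ t₀, ∃ x ≠ 0, T t x = 0 := by
  by_contra! hker
  have hunit : ∀ t ≥ t₀, IsUnit (T t) := fun t ht =>
    (hgard t ht).isUnit hU fun x => not_imp_not.1 (hker t ht x)
  obtain ⟨k, hk⟩ := (hgard t₀ le_rfl).exists_not_negIndexGE hU
  obtain ⟨t, ht, hkt⟩ := hneg k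
  exact hk ((negIndexGE_iff_of_isPreconnected isPreconnected_Ici hcont hsa hunit ht
    (Set.self_mem_Ici) k).1 hkt)

end DefiniteSplitting

section HilbertSchmidt

variable {𝕜 H L : Type*} [RCLike 𝕜]
variable [NormedAddCommGroup H] [InnerProductSpace 𝕜 H]

theorem isCompactOperator_of_sum_norm_sq_le [NormedAddCommGroup L] [InnerProductSpace 𝕜 L]
    [CompleteSpace L] {U : H →L[𝕜] L} {C : ℝ}
    (hU : ∀ (n : ℕ) (e : Fin n → H), Orthonormal 𝕜 e → ∑ i, ‖U (e i)‖ ^ 2 ≤ C) :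
    IsCompactOperator U := by
  refine isCompactOperator_of_forall_exists_finiteDimensional fun ε hε => ?_
  let A : Set ℝ := {a | ∃ (n : ℕ) (e : Fin n → H), Orthonormal 𝕜 e ∧ ∑ i, ‖U (e i)‖ ^ 2 = a}
  have hA : BddAbove A := ⟨C, by rintro _ ⟨n, e, he, rfl⟩; exact hU n e he⟩
  have hA_ne : A.Nonempty := ⟨0, 0, Fin.elim0, by simp, by simp⟩
  -- a family nearly attaining the supremum cannot be extended by a vector on which `U` is large
  obtain ⟨_, ⟨n, e, he, rfl⟩, hlt⟩ := exists_lt_of_lt_csSup hA_ne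
    (sub_lt_self (sSup A) (pow_pos hε 2))
  let F := Submodule.span 𝕜 (Set.range e)
  refine ⟨F, FiniteDimensional.span_of_finite 𝕜 (Set.finite_range e), fun x hx =>
    norm_apply_le_of_forall_norm_eq_one (fun u hu hu1 => ?_) hx⟩
  have hue : Orthonormal 𝕜 (Matrix.vecCons u e : Fin (n + 1) → H) := by
    rw [orthonormal_vecCons_iff]
    exact ⟨hu1, fun i => Submodule.inner_left_of_mem_orthogonal
      (Submodule.subset_span (Set.mem_range_self i)) hu, he⟩
  have hsup : ‖U u‖ ^ 2 + ∑ i, ‖U (e i)‖ ^ 2 ≤ sSup A := by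
    refine le_csSup hA ⟨n + 1, Matrix.vecCons u e, hue, ?_⟩
    simp [Fin.sum_univ_succ]
  exact (sq_le_sq₀ (norm_nonneg _) hε.le).1 (by linarith)

theorem sum_norm_sq_le_of_forall_norm_sum_mul_le {ι : Type*} [Fintype ι] {a : ι → 𝕜} {K : ℝ}
    (h : ∀ c : EuclideanSpace 𝕜 ι, ‖∑ i, c i * a i‖ ≤ K * ‖c‖) : ∑ i, ‖a i‖ ^ 2 ≤ K ^ 2 := by
  let c : EuclideanSpace 𝕜 ι := WithLp.toLp 2 fun i => starRingEnd 𝕜 (a i)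
  have hc : ‖c‖ ^ 2 = ∑ i, ‖a i‖ ^ 2 := by simp [c, EuclideanSpace.norm_sq_eq]
  have hca : ‖∑ i, c i * a i‖ = ‖c‖ ^ 2 := by
    have : ∑ i, c i * a i = ((‖c‖ ^ 2 : ℝ) : 𝕜) := by
      rw [hc]
      push_cast
      exact Finset.sum_congr rfl fun i _ => RCLike.conj_mul (a i)
    rw [this, RCLike.norm_ofReal, abs_of_nonneg (sq_nonneg _)]
  have hcK : ‖c‖ ^ 2 ≤ K * ‖c‖ := hca ▸ h c
  rw [← hc]
  rcases (norm_nonneg c).eq_or_lt with h0 | h0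
  · simpa [← h0] using sq_nonneg K
  · have : ‖c‖ ≤ K := le_of_mul_le_mul_right (by rwa [← sq]) h0
    gcongr

theorem norm_sum_smul_of_orthonormal {ι : Type*} [Fintype ι] {e : ι → H} (he : Orthonormal 𝕜 e)
    (c : EuclideanSpace 𝕜 ι) : ‖∑ i, c i • e i‖ = ‖c‖ := by
  have : ‖∑ i, c i • e i‖ ^ 2 = ‖c‖ ^ 2 := by
    have h := he.inner_sum c c Finset.univ
    simp only [inner_self_eq_norm_sq_to_K, RCLike.conj_mul] at h
    rw [EuclideanSpace.norm_sq_eq]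
    exact_mod_cast h
  rwa [sq_eq_sq₀ (norm_nonneg _) (norm_nonneg _)] at this

variable {α : Type*} [MeasurableSpace α] {μ : Measure α} {U : H →L[𝕜] Lp 𝕜 2 μ} {K : α → ℝ}

theorem ae_sum_norm_sq_le (hU : ∀ h, ∀ᵐ x ∂μ, ‖U h x‖ ≤ K x * ‖h‖) {ι : Type*} [Fintype ι]
    {e : ι → H} (he : Orthonormal 𝕜 e) : ∀ᵐ x ∂μ, ∑ i, ‖U (e i) x‖ ^ 2 ≤ K x ^ 2 := by
  have hdense : ∀ᵐ x ∂μ, ∀ j, ‖∑ i, TopologicalSpace.denseSeq (EuclideanSpace 𝕜 ι) j i * U (e i) x‖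
      ≤ K x * ‖TopologicalSpace.denseSeq (EuclideanSpace 𝕜 ι) j‖ := by
    refine ae_all_iff.2 fun j => ?_
    set c := TopologicalSpace.denseSeq (EuclideanSpace 𝕜 ι) j
    have hsmul : ∀ᵐ x ∂μ, ∀ i, (c i • U (e i)) x = c i * U (e i) x :=
      ae_all_iff.2 fun i => Lp.coeFn_smul (c i) (U (e i))
    filter_upwards [hU (∑ i, c i • e i), Lp.coeFn_fun_finsetSum Finset.univ fun i => c i • U (e i),
      hsmul] with x hx hsum hsmul
    simp only [map_sum, map_smul, hsum, hsmul, norm_sum_smul_of_orthonormal he] at hx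
    exact hx
  filter_upwards [hdense] with x hx
  refine sum_norm_sq_le_of_forall_norm_sum_mul_le fun c => ?_
  refine (TopologicalSpace.denseRange_denseSeq (EuclideanSpace 𝕜 ι)).induction_on
    (p := fun c => ‖∑ i, c i * U (e i) x‖ ≤ K x * ‖c‖) c ?_ hx
  exact isClosed_le (by fun_prop) (by fun_prop)

theorem norm_sq_eq_integral {E : Type*} [NormedAddCommGroup E] (u : Lp E 2 μ) :
    ‖u‖ ^ 2 = ∫ x, ‖u x‖ ^ 2 ∂μ := by
  rw [Lp.norm_def, (Lp.memLp u).eLpNorm_eq_integral_rpow_norm two_ne_zero ENNReal.ofNat_ne_top,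
    ENNReal.toReal_ofReal (by positivity)]
  simp only [ENNReal.toReal_ofNat, Real.rpow_two]
  rw [← Real.rpow_natCast, ← Real.rpow_mul (by positivity)]
  norm_num

theorem integrable_norm_sq {E : Type*} [NormedAddCommGroup E] (u : Lp E 2 μ) :
    Integrable (fun x => ‖u x‖ ^ 2) μ :=
  (Lp.memLp u).norm.integrable_sq

theorem isCompactOperator_of_ae_norm_le (hK : MemLp K 2 μ)
    (hU : ∀ h, ∀ᵐ x ∂μ, ‖U h x‖ ≤ K x * ‖h‖) : IsCompactOperator U := by
  refine isCompactOperator_of_sum_norm_sq_le (C := ∫ x, K x ^ 2 ∂μ) fun n e he => ?_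
  simp only [norm_sq_eq_integral]
  rw [← integral_finsetSum _ fun i _ => integrable_norm_sq (U (e i))]
  exact integral_mono_ae (integrable_finsetSum _ fun i _ => integrable_norm_sq (U (e i)))
    hK.integrable_sq (ae_sum_norm_sq_le hU he)

end HilbertSchmidt

theorem ae_norm_le_mul_norm_of_denseRange {𝕜 H E α D : Type*} [NontriviallyNormedField 𝕜]
    [NormedAddCommGroup H] [NormedSpace 𝕜 H] [NormedAddCommGroup E] [NormedSpace 𝕜 E]
    [MeasurableSpace α] {μ : Measure α} {p : ENNReal} [Fact (1 ≤ p)] {U : H →L[𝕜] Lp E p μ}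
    {K : α → ℝ} {T : D → H} (hT : DenseRange T) (hU : ∀ d, ∀ᵐ x ∂μ, ‖U (T d) x‖ ≤ K x * ‖T d‖)
    (h : H) : ∀ᵐ x ∂μ, ‖U h x‖ ≤ K x * ‖h‖ := by
  obtain ⟨d, hd⟩ : ∃ d : ℕ → D, Tendsto (fun n => T (d n)) atTop (𝓝 h) := by
    obtain ⟨y, hy, hyh⟩ := mem_closure_iff_seq_limit.1 (hT h)
    choose d hd using hy
    exact ⟨d, by simpa only [hd] using hyh⟩
  have hU_tendsto : Tendsto (fun n => U (T (d n))) atTop (𝓝 (U h)) :=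
    (U.continuous.tendsto h).comp hd
  obtain ⟨ns, hns, hlim⟩ := (tendstoInMeasure_of_tendsto_Lp hU_tendsto).exists_seq_tendsto_ae
  filter_upwards [hlim, ae_all_iff.2 fun n => hU (d n)] with x hx hle
  exact le_of_tendsto_of_tendsto' hx.norm
    ((hd.comp hns.tendsto_atTop).norm.const_mul (K x)) fun n => hle (ns n)

section Multiplication

variable {α : Type*} [MeasurableSpace α] {μ : Measure α} {b : α → ℝ}

/-- Multiplication by an essentially bounded real function, as a bounded operator on `L²(μ)`. -/
noncomputable def mulOp (b : α → ℝ) (hb : MemLp b ⊤ μ) : Lp ℂ 2 μ →L[ℂ] Lp ℂ 2 μ :=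
  (ContinuousLinearMap.mul ℂ ℂ).holderL μ ⊤ 2 2 (hb.ofReal (K := ℂ)).toLp

theorem coeFn_mulOp (hb : MemLp b ⊤ μ) (u : Lp ℂ 2 μ) :
    mulOp b hb u =ᵐ[μ] fun x => (b x : ℂ) * u x := by
  filter_upwards [(ContinuousLinearMap.mul ℂ ℂ).coeFn_holder (r := 2) hb.ofReal.toLp u,
    (hb.ofReal (K := ℂ)).coeFn_toLp] with x hx hbx
  exact hx.trans (by rw [hbx]; rfl)

theorem mulOp_injective (hb : MemLp b ⊤ μ) (hb₀ : ∀ᵐ x ∂μ, b x ≠ 0) :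
    Function.Injective (mulOp b hb) := by
  rw [injective_iff_map_eq_zero]
  intro u hu
  rw [Lp.eq_zero_iff_ae_eq_zero] at hu ⊢
  filter_upwards [hu, coeFn_mulOp hb u, hb₀] with x hx hmul hbx
  rw [hmul] at hx
  exact (mul_eq_zero.1 hx).resolve_left (Complex.ofReal_ne_zero.2 hbx)

theorem norm_mulOp_le_of_ae_norm_le (hb : MemLp b ⊤ μ) {u v : Lp ℂ 2 μ} {c : ℝ}
    (huv : ∀ᵐ x ∂μ, ‖u x‖ ≤ c * ‖v x‖) : ‖mulOp b hb u‖ ≤ c * ‖mulOp b hb v‖ := by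
  refine Lp.norm_le_mul_norm_of_ae_le_mul ?_
  filter_upwards [huv, coeFn_mulOp hb u, coeFn_mulOp hb v] with x hx hu hv
  rw [hu, hv, norm_mul, norm_mul, mul_left_comm]
  gcongr

theorem inner_mulOp_left (hb : MemLp b ⊤ μ) (u v : Lp ℂ 2 μ) :
    inner ℂ (mulOp b hb u) v = ∫ x, (b x : ℂ) * inner ℂ (u x) (v x) ∂μ := by
  rw [L2.inner_def]
  refine integral_congr_ae ?_
  filter_upwards [coeFn_mulOp hb u] with x hx
  rw [hx, ← smul_eq_mul, inner_smul_left, Complex.conj_ofReal]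

theorem inner_mulOp_comm (hb : MemLp b ⊤ μ) (u v : Lp ℂ 2 μ) :
    inner ℂ (mulOp b hb u) v = inner ℂ u (mulOp b hb v) := by
  rw [inner_mulOp_left, L2.inner_def]
  refine integral_congr_ae ?_
  filter_upwards [coeFn_mulOp hb v] with x hx
  rw [hx, ← smul_eq_mul (b x : ℂ) (v x), inner_smul_right]

theorem re_inner_mulOp (hb : MemLp b ⊤ μ) (u : Lp ℂ 2 μ) :
    (inner ℂ (mulOp b hb u) u).re = ∫ x, b x * ‖u x‖ ^ 2 ∂μ := by
  have (x : α) : (b x : ℂ) * inner ℂ (u x) (u x) = ((b x * ‖u x‖ ^ 2 : ℝ) : ℂ) := by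
    simp [inner_self_eq_norm_sq_to_K]
  simp only [inner_mulOp_left, this, integral_complex_ofReal, Complex.ofReal_re]

theorem integrable_mul_norm_sq (hb : MemLp b ⊤ μ) (u : Lp ℂ 2 μ) :
    Integrable (fun x => b x * ‖u x‖ ^ 2) μ :=
  memLp_one_iff_integrable.1 ((memLp_one_iff_integrable.2 (integrable_norm_sq u)).mul hb)

theorem le_re_inner_mulOp (hb : MemLp b ⊤ μ) {c : ℝ} (hcb : ∀ᵐ x ∂μ, c ≤ b x) (u : Lp ℂ 2 μ) :
    c * ‖u‖ ^ 2 ≤ (inner ℂ (mulOp b hb u) u).re := by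
  rw [re_inner_mulOp, norm_sq_eq_integral, ← integral_const_mul]
  refine integral_mono_ae ((integrable_norm_sq u).const_mul c) (integrable_mul_norm_sq hb u) ?_
  filter_upwards [hcb] with x hx using by gcongr

theorem re_inner_mulOp_le (hb : MemLp b ⊤ μ) {c : ℝ} (hbc : ∀ᵐ x ∂μ, b x ≤ c) (u : Lp ℂ 2 μ) :
    (inner ℂ (mulOp b hb u) u).re ≤ c * ‖u‖ ^ 2 := by
  rw [re_inner_mulOp, norm_sq_eq_integral, ← integral_const_mul]
  refine integral_mono_ae (integrable_mul_norm_sq hb u) ((integrable_norm_sq u).const_mul c) ?_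
  filter_upwards [hbc] with x hx using by gcongr

theorem exists_ae_norm_le {E : Type*} [NormedAddCommGroup E] {f : α → E} (hf : MemLp f ⊤ μ) :
    ∃ C, ∀ᵐ x ∂μ, ‖f x‖ ≤ C := by
  have hfin : eLpNormEssSup f μ ≠ ⊤ := by simpa using hf.2.ne
  refine ⟨(eLpNormEssSup f μ).toReal, ?_⟩
  filter_upwards [ae_le_eLpNormEssSup (f := f) (μ := μ)] with x hx
  exact toReal_enorm (f x) ▸ ENNReal.toReal_mono hfin hx

theorem memLp_top_inv {V : α → ℝ} (hV : AEStronglyMeasurable V μ) {δ : ℝ} (hδ : 0 < δ)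
    (hVδ : ∀ᵐ x ∂μ, δ ≤ V x) : MemLp V⁻¹ ⊤ μ := by
  refine memLp_top_of_bound hV.aemeasurable.inv.aestronglyMeasurable δ⁻¹ ?_
  filter_upwards [hVδ] with x hx
  rw [Pi.inv_apply, Real.norm_of_nonneg (inv_nonneg.2 (hδ.le.trans hx))]
  exact inv_anti₀ hδ hx

end Multiplication

section graphClosure

variable {D L : Type*} [AddCommGroup D] [Module ℂ D]
variable [NormedAddCommGroup L] [InnerProductSpace ℂ L]

/-- The closure in `L × L` of `{(P f, ι f) | f ∈ D}`: for an operator `P` on a space `D` embedded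
by `ι`, this is the domain of the closure of `P`, with the graph norm. In the application it plays
the role of `H₀^{P₀}(Ω)`. -/
abbrev graphClosure (P ι : D →ₗ[ℂ] L) : Submodule ℂ (WithLp 2 (L × L)) :=
  (LinearMap.range
    ((WithLp.linearEquiv 2 ℂ (L × L)).symm.toLinearMap ∘ₗ P.prod ι)).topologicalClosure

namespace graphClosure

variable {P ι : D →ₗ[ℂ] L}

instance [CompleteSpace L] : CompleteSpace (graphClosure P ι) :=
  Submodule.topologicalClosure.completeSpace _

variable (P ι) in
/-- The canonical map of the core `D` to the graph closure. -/
noncomputable def ofCore : D →ₗ[ℂ] graphClosure P ι :=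
  ((WithLp.linearEquiv 2 ℂ (L × L)).symm.toLinearMap ∘ₗ P.prod ι).codRestrict _ fun f =>
    Submodule.le_topologicalClosure _ ⟨f, rfl⟩

/-- The closure of `P`. -/
noncomputable def op : graphClosure P ι →L[ℂ] L :=
  WithLp.fstL 2 ℂ L L ∘L (graphClosure P ι).subtypeL

/-- The extension of `ι` to the graph closure. -/
noncomputable def incl : graphClosure P ι →L[ℂ] L :=
  WithLp.sndL 2 ℂ L L ∘L (graphClosure P ι).subtypeL

@[simp]
theorem op_ofCore (f : D) : op (ofCore P ι f) = P f := rfl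

@[simp]
theorem incl_ofCore (f : D) : incl (ofCore P ι f) = ι f := rfl

theorem norm_sq_eq (h : graphClosure P ι) : ‖h‖ ^ 2 = ‖op h‖ ^ 2 + ‖incl h‖ ^ 2 :=
  WithLp.prod_norm_sq_eq_of_L2 (h : WithLp 2 (L × L))

theorem norm_op_le (h : graphClosure P ι) : ‖op h‖ ≤ ‖h‖ :=
  (sq_le_sq₀ (norm_nonneg _) (norm_nonneg _)).1 (by nlinarith [norm_sq_eq h])

theorem norm_incl_le (h : graphClosure P ι) : ‖incl h‖ ≤ ‖h‖ :=
  (sq_le_sq₀ (norm_nonneg _) (norm_nonneg _)).1 (by nlinarith [norm_sq_eq h])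

theorem denseRange_ofCore : DenseRange (ofCore P ι) := fun h =>
  Metric.mem_closure_range_iff.2 fun ε hε => by
    obtain ⟨⟨_, f, rfl⟩, hf⟩ := Metric.mem_closure_range_iff.1
      (show (h : WithLp 2 (L × L)) ∈ closure (Set.range Subtype.val) by
        rw [Subtype.range_coe]; exact h.2) ε hε
    exact ⟨f, hf⟩

theorem inner_op_incl (hsymm : ∀ f g, inner ℂ (P f) (ι g) = inner ℂ (ι f) (P g))
    (h g : graphClosure P ι) : inner ℂ (op h) (incl g) = inner ℂ (incl h) (op g) :=
  denseRange_ofCore.induction_on₂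
    (p := fun h g => inner ℂ (op h) (incl g) = inner ℂ (incl h) (op g))
    (isClosed_eq (by fun_prop) (by fun_prop)) hsymm h g

end graphClosure

end graphClosure

section Pencil

variable {H L : Type*} [NormedAddCommGroup H] [InnerProductSpace ℂ H]
variable [NormedAddCommGroup L] [InnerProductSpace ℂ L]
variable {A J : H →L[ℂ] L} {W : L →L[ℂ] L} {δ t : ℝ} {h : H}

/-- The operator `P - t`, where `P` is an operator in `L` whose domain is presented as a space `H`
with embedding `J : H → L`, and `A : H → L` is the action of `P`. -/
def shift (A J : H →L[ℂ] L) (t : ℝ) : H →L[ℂ] L := A - (t : ℂ) • J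

theorem shift_apply (A J : H →L[ℂ] L) (t : ℝ) (h : H) : shift A J t h = A h - (t : ℂ) • J h := rfl

theorem continuous_shift (A J : H →L[ℂ] L) : Continuous (shift A J) := by
  unfold shift
  fun_prop

/-- The function `w` of a transmission pair `(v, w)`, recovered from the difference `h = v - w`: the
two equations give `(P - t) h = - t V w`, and `W` is the multiplication by `1 / V`. -/
noncomputable def transmitted (A J : H →L[ℂ] L) (W : L →L[ℂ] L) (t : ℝ) (h : H) : L :=
  -(t : ℂ)⁻¹ • W (shift A J t h)

variable [CompleteSpace H] [CompleteSpace L]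

/-- The operator of the sesquilinear form `⟪W (P - t) h, (P - t) g⟫ - t ⟪(P - t) h, g⟫`. With `W`
the multiplication by `1 / V`, its kernel consists of the differences `v - w` of the solutions of
the transmission problem with parameter `t`. -/
noncomputable def pencil (A J : H →L[ℂ] L) (W : L →L[ℂ] L) (t : ℝ) : H →L[ℂ] H :=
  (shift A J t).adjoint ∘L W ∘L shift A J t - J.adjoint ∘L ((t : ℂ) • shift A J t)

theorem inner_pencil (h g : H) :
    inner ℂ (pencil A J W t h) g =
      inner ℂ (W (shift A J t h)) (shift A J t g) - t * inner ℂ (shift A J t h) (J g) := by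
  have : pencil A J W t h =
    (shift A J t).adjoint (W (shift A J t h)) - J.adjoint ((t : ℂ) • shift A J t h) := rfl
  rw [this, inner_sub_left, ContinuousLinearMap.adjoint_inner_left,
    ContinuousLinearMap.adjoint_inner_left, inner_smul_left, Complex.conj_ofReal]

theorem continuous_pencil (A J : H →L[ℂ] L) (W : L →L[ℂ] L) : Continuous (pencil A J W) := by
  have hadjoint : Continuous fun t => (shift A J t).adjoint :=
    (ContinuousLinearMap.adjoint (𝕜 := ℂ) (E := H) (F := L)).continuous.comp (continuous_shift A J)
  exact (hadjoint.clm_comp (continuous_const.clm_comp (continuous_shift A J))).sub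
    (continuous_const.clm_comp (Complex.continuous_ofReal.smul (continuous_shift A J)))

theorem isSelfAdjoint_pencil (hsymm : ∀ h g, inner ℂ (A h) (J g) = inner ℂ (J h) (A g))
    (hW : ∀ u v, inner ℂ (W u) v = inner ℂ u (W v)) (t : ℝ) : IsSelfAdjoint (pencil A J W t) := by
  rw [ContinuousLinearMap.isSelfAdjoint_iff_isSymmetric]
  intro h g
  change inner ℂ (pencil A J W t h) g = inner ℂ h (pencil A J W t g)
  rw [← inner_conj_symm h, inner_pencil, inner_pencil, map_sub, map_mul, inner_conj_symm,
    inner_conj_symm, Complex.conj_ofReal, hW]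
  simp only [shift_apply, inner_sub_left, inner_sub_right, inner_smul_left, inner_smul_right,
    Complex.conj_ofReal, hsymm]

theorem satisfiesGarding_pencil {c : ℝ} (hc : 0 < c)
    (hW : ∀ u, c * ‖u‖ ^ 2 ≤ (inner ℂ (W u) u).re)
    (hnorm : ∀ h, ‖h‖ ^ 2 = ‖A h‖ ^ 2 + ‖J h‖ ^ 2) (t : ℝ) :
    SatisfiesGarding J (pencil A J W t) := by
  refine ⟨c / 4, by positivity, c / 2 * t ^ 2 + c / 4 + t ^ 2 / (2 * c), fun h => ?_⟩
  rw [inner_pencil, Complex.sub_re, Complex.re_ofReal_mul, hnorm]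
  set e := ‖shift A J t h‖
  set u := ‖J h‖
  have hop : ‖A h‖ ^ 2 ≤ 2 * e ^ 2 + 2 * t ^ 2 * u ^ 2 := by
    calc ‖A h‖ ^ 2 = ‖shift A J t h + (t : ℂ) • J h‖ ^ 2 := by rw [shift_apply, sub_add_cancel]
      _ ≤ (e + |t| * u) ^ 2 := by
        gcongr
        exact (norm_add_le _ _).trans_eq (by rw [norm_smul, Complex.norm_real, Real.norm_eq_abs])
      _ ≤ 2 * (e ^ 2 + (|t| * u) ^ 2) := add_sq_le
      _ = _ := by rw [mul_pow, sq_abs]; ring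
  have hcross :
      t * (inner ℂ (shift A J t h) (J h)).re ≤ c / 2 * e ^ 2 + t ^ 2 / (2 * c) * u ^ 2 := by
    calc t * (inner ℂ (shift A J t h) (J h)).re ≤ |t| * (e * u) := by
          refine (le_abs_self _).trans ?_
          rw [abs_mul]
          gcongr
          exact (Complex.abs_re_le_norm _).trans (norm_inner_le_norm _ _)
      _ = c / 2 * e ^ 2 + t ^ 2 / (2 * c) * u ^ 2 - (c * e - |t| * u) ^ 2 / (2 * c) := by
          rw [← sq_abs t]
          field_simp
          ring
      _ ≤ _ := sub_le_self _ (by positivity)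
  linarith [hW (shift A J t h), mul_le_mul_of_nonneg_left hop hc.le]

theorem re_inner_pencil_neg (hδ : 0 < δ) (ht : 0 < t)
    (hW : ∀ u, (inner ℂ (W u) u).re ≤ δ⁻¹ * ‖u‖ ^ 2) (hh : J h ≠ 0)
    (hquasi : ‖A h - ((t * (1 + δ / 2) : ℝ) : ℂ) • J h‖ ≤ δ / 16 * t * ‖J h‖) :
    (inner ℂ (pencil A J W t h) h).re < 0 := by
  set u := J h
  set r := A h - ((t * (1 + δ / 2) : ℝ) : ℂ) • u
  have hshift : shift A J t h = r + ((t * (δ / 2) : ℝ) : ℂ) • u := by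
    simp only [shift_apply, r, u]
    push_cast
    module
  have hu : 0 < ‖u‖ := norm_pos_iff.2 hh
  have hupper : ‖shift A J t h‖ ≤ 9 / 16 * δ * t * ‖u‖ := by
    calc ‖shift A J t h‖ ≤ ‖r‖ + ‖((t * (δ / 2) : ℝ) : ℂ) • u‖ := hshift ▸ norm_add_le _ _
      _ = ‖r‖ + t * (δ / 2) * ‖u‖ := by
        rw [norm_smul, Complex.norm_real, Real.norm_of_nonneg (by positivity)]
      _ ≤ _ := by linarith
  have hlower : 7 / 16 * δ * t * ‖u‖ ^ 2 ≤ (inner ℂ (shift A J t h) u).re := by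
    have hr : -(‖r‖ * ‖u‖) ≤ (inner ℂ r u).re :=
      (abs_le.1 ((Complex.abs_re_le_norm _).trans (norm_inner_le_norm r u))).1
    have huu : (inner ℂ u u).re = ‖u‖ ^ 2 := (norm_sq_eq_re_inner (𝕜 := ℂ) u).symm
    rw [hshift, inner_add_left, inner_smul_left, Complex.add_re, Complex.conj_ofReal,
      Complex.re_ofReal_mul, huu]
    nlinarith [mul_le_mul_of_nonneg_right hquasi hu.le]
  rw [inner_pencil, Complex.sub_re, Complex.re_ofReal_mul, sub_neg]
  calc (inner ℂ (W (shift A J t h)) (shift A J t h)).re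
      ≤ δ⁻¹ * (9 / 16 * δ * t * ‖u‖) ^ 2 := (hW _).trans (by gcongr)
    _ = 81 / 256 * (δ * t ^ 2 * ‖u‖ ^ 2) := by field_simp; ring
    _ < t * (7 / 16 * δ * t * ‖u‖ ^ 2) := by
      have : 0 < δ * t ^ 2 * ‖u‖ ^ 2 := by positivity
      linarith
    _ ≤ t * (inner ℂ (shift A J t h) u).re := by gcongr

theorem inner_shift_transmitted (ht : t ≠ 0) (hker : pencil A J W t h = 0) (g : H) :
    inner ℂ (shift A J t g) (transmitted A J W t h) = -inner ℂ (J g) (shift A J t h) := by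
  have hform : inner ℂ (W (shift A J t h)) (shift A J t g) = t * inner ℂ (shift A J t h) (J g) := by
    rw [← sub_eq_zero, ← inner_pencil, hker, inner_zero_left]
  have hconj : inner ℂ (shift A J t g) (W (shift A J t h)) = t * inner ℂ (J g) (shift A J t h) := by
    rw [← inner_conj_symm, hform, map_mul, inner_conj_symm, Complex.conj_ofReal]
  rw [transmitted, inner_smul_right, hconj, neg_mul, ← mul_assoc,
    inv_mul_cancel₀ (by exact_mod_cast ht), one_mul]

theorem inner_apply_transmitted (ht : t ≠ 0) (hker : pencil A J W t h = 0) (g : H) :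
    inner ℂ (A g) (transmitted A J W t h) =
      inner ℂ (J g) ((t : ℂ) • (J h + transmitted A J W t h) - A h) := by
  have hsub : (t : ℂ) • (J h + transmitted A J W t h) - A h =
      (t : ℂ) • transmitted A J W t h - shift A J t h := by
    rw [shift_apply]
    module
  rw [hsub, inner_sub_right, sub_eq_add_neg, ← inner_shift_transmitted ht hker, shift_apply,
    inner_sub_left, inner_smul_left, inner_smul_right, Complex.conj_ofReal, add_sub_cancel]

theorem inner_apply_add_transmitted
    (hsymm : ∀ h g, inner ℂ (A h) (J g) = inner ℂ (J h) (A g)) (ht : t ≠ 0)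
    (hker : pencil A J W t h = 0) (g : H) :
    inner ℂ (A g) (J h + transmitted A J W t h) =
      inner ℂ (J g) ((t : ℂ) • (J h + transmitted A J W t h)) := by
  rw [inner_add_right, hsymm, inner_apply_transmitted ht hker, ← inner_add_right, add_sub_cancel]

end Pencil

section Schwartz

open SchwartzMap FourierTransform LineDeriv Laplacian
open scoped SchwartzMap

variable {E : Type*} [NormedAddCommGroup E] [InnerProductSpace ℝ E]

theorem lineDeriv_smulLeftCLM_inner (e m : E) (ψ : 𝓢(E, ℂ)) :
    ∂_{m} (smulLeftCLM ℂ (inner ℝ · e : E → ℝ) ψ) =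
      inner ℝ m e • ψ + smulLeftCLM ℂ (inner ℝ · e : E → ℝ) (∂_{m} ψ) := by
  have hgrowth : (inner ℝ · e : E → ℝ).HasTemperateGrowth := by fun_prop
  ext x
  have hinner : HasFDerivAt (fun x : E => inner ℝ x e) ((innerSL ℝ).flip e) x :=
    ((innerSL ℝ).flip e).hasFDerivAt
  rw [lineDerivOp_apply_eq_fderiv, add_apply, smulLeftCLM_apply_apply hgrowth,
    smulLeftCLM_apply hgrowth]
  rw [show fderiv ℝ (fun x => inner ℝ x e • ψ x) x = _ from
    (hinner.smul (ψ.hasFDerivAt x)).fderiv]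
  simp [lineDerivOp_apply_eq_fderiv, real_inner_comm e, innerSL_apply_apply ℝ e m]
  ring

variable [FiniteDimensional ℝ E] [MeasurableSpace E] [BorelSpace E]

/-- A Schwartz function as an element of `L²`. -/
noncomputable def toL2 : 𝓢(E, ℂ) →ₗ[ℂ] Lp ℂ 2 (volume : Measure E) :=
  (toLpCLM ℂ ℂ 2 volume : 𝓢(E, ℂ) →L[ℂ] Lp ℂ 2 (volume : Measure E)).toLinearMap

theorem coeFn_toL2 (f : 𝓢(E, ℂ)) : toL2 f =ᵐ[volume] f := f.coeFn_toLp 2 volume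

theorem norm_toL2_fourier (f : 𝓢(E, ℂ)) : ‖toL2 (𝓕 f)‖ = ‖toL2 f‖ := norm_fourier_toL2_eq f

theorem inner_toL2 (f g : 𝓢(E, ℂ)) : inner ℂ (toL2 f) (toL2 g) = ∫ x, inner ℂ (f x) (g x) :=
  inner_toL2_toL2_eq (μ := volume) f g

theorem norm_toL2 (f : 𝓢(E, ℂ)) : ‖toL2 f‖ = (∫ x, ‖f x‖ ^ (2 : ℝ)) ^ (1 / (2 : ℝ)) := by
  simpa [toL2] using norm_toLp' (f := f) (μ := volume) two_ne_zero ENNReal.ofNat_ne_top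

theorem norm_toL2_le_of_norm_le {f g : 𝓢(E, ℂ)} {c : ℝ} (h : ∀ x, ‖f x‖ ≤ c * ‖g x‖) :
    ‖toL2 f‖ ≤ c * ‖toL2 g‖ := by
  refine Lp.norm_le_mul_norm_of_ae_le_mul ?_
  filter_upwards [coeFn_toL2 f, coeFn_toL2 g] with x hf hg
  simpa only [hf, hg] using h x

theorem fourier_sub (f g : 𝓢(E, ℂ)) : 𝓕 (f - g) = 𝓕 f - 𝓕 g :=
  map_sub (FourierTransform.fourierCLM ℂ 𝓢(E, ℂ)) f g

theorem fourier_lineDeriv_apply (f : 𝓢(E, ℂ)) (m ξ : E) :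
    𝓕 (∂_{m} f) ξ = 2 * Real.pi * Complex.I * inner ℝ ξ m * 𝓕 f ξ := by
  have h : (inner ℝ · m : E → ℝ).HasTemperateGrowth := by fun_prop
  rw [fourier_lineDerivOp_eq]
  simp [h, mul_assoc]

theorem fourier_laplacian_apply (f : 𝓢(E, ℂ)) (ξ : E) :
    𝓕 (Δ f) ξ = -((2 * Real.pi) ^ 2 * ‖ξ‖ ^ 2) * 𝓕 f ξ := by
  have h : (fun x : E => ‖x‖ ^ 2).HasTemperateGrowth := by fun_prop
  rw [laplacian_eq_fourierMultiplierCLM, FourierTransform.fourier_smul, fourierMultiplierCLM_apply,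
    FourierTransform.fourier_fourierInv_eq, smul_apply, smulLeftCLM_apply_apply h]
  simp only [Complex.real_smul]
  push_cast
  ring

theorem inner_lineDeriv_right (f g : 𝓢(E, ℂ)) (m : E) :
    inner ℂ (toL2 f) (toL2 (∂_{m} g)) = -inner ℂ (toL2 (∂_{m} f)) (toL2 g) := by
  rw [inner_toL2, inner_toL2]
  have := integral_bilinear_lineDerivOp_right_eq_neg_left (μ := volume) f g
    ((ContinuousLinearMap.mul ℝ ℂ).comp (Complex.conjCLE : ℂ →L[ℝ] ℂ)) m
  simpa [mul_comm] using this

theorem inner_laplacian_right (f g : 𝓢(E, ℂ)) :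
    inner ℂ (toL2 f) (toL2 (Δ g)) = inner ℂ (toL2 (Δ f)) (toL2 g) := by
  rw [inner_toL2, inner_toL2]
  have := integral_bilinear_laplacian_right_eq_left (μ := volume) f g
    ((ContinuousLinearMap.mul ℝ ℂ).comp (Complex.conjCLE : ℂ →L[ℝ] ℂ))
  simpa [mul_comm] using this

theorem norm_apply_le_integral_norm_fourier (f : 𝓢(E, ℂ)) (x : E) : ‖f x‖ ≤ ∫ ξ, ‖𝓕 f ξ‖ := by
  have : f x = 𝓕 (𝓕 f) (-x) := by
    conv_lhs => rw [← FourierTransform.fourierInv_fourier_eq (F := 𝓢(E, ℂ)) f]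
    rw [fourierInv_apply_eq]
    simp
  rw [this]
  exact (norm_fourier_apply_le_toLp_one _ _).trans_eq norm_toLp_one

theorem norm_fourier_le_mul_norm_fourier_sub_laplacian (f : 𝓢(E, ℂ)) (ξ : E) :
    ‖𝓕 f ξ‖ ≤ (1 + ‖ξ‖ ^ 2)⁻¹ * ‖𝓕 (f - Δ f) ξ‖ := by
  have hsymbol : 𝓕 (f - Δ f) ξ = ((1 + (2 * Real.pi) ^ 2 * ‖ξ‖ ^ 2 : ℝ) : ℂ) * 𝓕 f ξ := by
    rw [fourier_sub, sub_apply, fourier_laplacian_apply]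
    push_cast
    ring
  have hpi : 1 ≤ (2 * Real.pi) ^ 2 := by nlinarith [Real.pi_gt_three]
  rw [hsymbol, norm_mul, Complex.norm_real, Real.norm_of_nonneg (by positivity), inv_mul_eq_div,
    le_div_iff₀ (by positivity), mul_comm]
  gcongr
  exact le_mul_of_one_le_left (by positivity) hpi

theorem memLp_two_inv_one_add_norm_sq (hE : Module.finrank ℝ E < 4) :
    MemLp (fun ξ : E => (1 + ‖ξ‖ ^ 2)⁻¹) 2 volume := by
  rw [memLp_two_iff_integrable_sq (by fun_prop)]
  refine (integrable_rpow_neg_one_add_norm_sq (r := 4) (by exact_mod_cast hE)).congr ?_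
  filter_upwards with ξ
  rw [show (-4 / 2 : ℝ) = -((2 : ℕ) : ℝ) by norm_num, Real.rpow_neg (by positivity),
    Real.rpow_natCast, inv_pow]

theorem exists_norm_apply_le_norm_sub_laplacian (hE : Module.finrank ℝ E < 4) :
    ∃ C, 0 ≤ C ∧ ∀ (f : 𝓢(E, ℂ)) (x : E), ‖f x‖ ≤ C * ‖toL2 (f - Δ f)‖ := by
  set w : E → ℝ := fun ξ => (1 + ‖ξ‖ ^ 2)⁻¹
  have hw : MemLp w 2 volume := memLp_two_inv_one_add_norm_sq hE
  have hw_nonneg : ∀ ξ, 0 ≤ w ξ := fun ξ => by positivity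
  refine ⟨(∫ ξ, w ξ ^ (2 : ℝ)) ^ (1 / (2 : ℝ)), by positivity, fun f x => ?_⟩
  have hF : MemLp (fun ξ => ‖𝓕 (f - Δ f) ξ‖) 2 volume := ((𝓕 (f - Δ f)).memLp 2 volume).norm
  calc ‖f x‖ ≤ ∫ ξ, ‖𝓕 f ξ‖ := norm_apply_le_integral_norm_fourier f x
    _ ≤ ∫ ξ, w ξ * ‖𝓕 (f - Δ f) ξ‖ :=
      integral_mono (𝓕 f).integrable.norm (hw.integrable_mul hF)
        (norm_fourier_le_mul_norm_fourier_sub_laplacian f)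
    _ ≤ (∫ ξ, w ξ ^ (2 : ℝ)) ^ (1 / (2 : ℝ)) *
        (∫ ξ, ‖𝓕 (f - Δ f) ξ‖ ^ (2 : ℝ)) ^ (1 / (2 : ℝ)) :=
      integral_mul_le_Lp_mul_Lq_of_nonneg Real.HolderConjugate.two_two (f := w)
        (g := fun ξ => ‖𝓕 (f - Δ f) ξ‖) (ae_of_all _ hw_nonneg) (ae_of_all _ fun _ => norm_nonneg _)
        (by simpa using hw) (by simpa using hF)
    _ = (∫ ξ, w ξ ^ (2 : ℝ)) ^ (1 / (2 : ℝ)) * ‖toL2 (f - Δ f)‖ := by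
      rw [← norm_toL2_fourier, norm_toL2]

/-- The operator on the right is `exp (τ e) (Δ + c') exp (- τ e)`. Its symbol has the imaginary part
`- 4 π τ ⟪ξ, e⟫`, twice `τ` times the symbol of the derivative. -/
theorem two_mul_abs_mul_norm_lineDeriv_le (τ c : ℝ) (e : E) (ψ : 𝓢(E, ℂ)) :
    2 * |τ| * ‖toL2 (∂_{e} ψ)‖ ≤
      ‖toL2 (Δ ψ - (2 * τ : ℂ) • ∂_{e} ψ + (c : ℂ) • ψ)‖ := by
  rw [← norm_toL2_fourier (∂_{e} ψ),
    ← norm_toL2_fourier (Δ ψ - (2 * τ : ℂ) • ∂_{e} ψ + (c : ℂ) • ψ)]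
  have hnorm : ‖((2 * |τ| : ℝ) : ℂ)‖ = 2 * |τ| := by
    rw [Complex.norm_real, Real.norm_of_nonneg (by positivity)]
  rw [← hnorm, ← norm_smul, ← map_smul]
  refine (norm_toL2_le_of_norm_le (c := 1) fun ξ => ?_).trans_eq (one_mul _)
  have hsymbol : 𝓕 (Δ ψ - (2 * τ : ℂ) • ∂_{e} ψ + (c : ℂ) • ψ) ξ =
      (((-((2 * Real.pi) ^ 2 * ‖ξ‖ ^ 2) + c : ℝ) : ℂ)
        + ((-(2 * τ * (2 * Real.pi * inner ℝ ξ e)) : ℝ) : ℂ) * Complex.I) * 𝓕 ψ ξ := by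
    rw [FourierTransform.fourier_add, fourier_sub, FourierTransform.fourier_smul,
      FourierTransform.fourier_smul]
    simp only [add_apply, sub_apply, smul_apply, fourier_lineDeriv_apply, fourier_laplacian_apply,
      smul_eq_mul]
    push_cast
    ring
  rw [hsymbol, one_mul, smul_apply, fourier_lineDeriv_apply, smul_eq_mul, ← mul_assoc, norm_mul,
    norm_mul _ (𝓕 ψ ξ)]
  gcongr
  refine le_trans (le_of_eq ?_) (Complex.abs_im_le_norm _)
  rw [Complex.add_im, Complex.ofReal_im, Complex.mul_I_im, Complex.ofReal_re, zero_add, abs_neg]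
  simp only [Complex.norm_real, norm_mul, Complex.norm_I, Complex.norm_ofNat, Real.norm_eq_abs,
    abs_mul, abs_abs, abs_two, abs_of_pos Real.pi_pos]
  ring

theorem norm_smulLeftCLM_inner_le {R : ℝ} {e : E} {ψ : 𝓢(E, ℂ)}
    (hψ : tsupport ψ ⊆ {x | |inner ℝ x e| ≤ R}) :
    ‖toL2 (smulLeftCLM ℂ (inner ℝ · e : E → ℝ) ψ)‖ ≤ R * ‖toL2 ψ‖ :=
  norm_toL2_le_of_norm_le fun x => by
    rw [smulLeftCLM_apply_apply (by fun_prop), norm_smul, Real.norm_eq_abs]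
    by_cases hx : ψ x = 0
    · simp [hx]
    · gcongr
      exact hψ (subset_tsupport _ hx)

/-- Poincaré's inequality in a slab, from the identity `∂_e (⟪x, e⟫ ψ) = ψ + ⟪x, e⟫ ∂_e ψ`. -/
theorem norm_le_mul_norm_lineDeriv_of_tsupport_subset {R : ℝ} (hR : 0 ≤ R) {e : E} (he : ‖e‖ = 1)
    {ψ : 𝓢(E, ℂ)} (hψ : tsupport ψ ⊆ {x | |inner ℝ x e| ≤ R}) :
    ‖toL2 ψ‖ ≤ 2 * R * ‖toL2 (∂_{e} ψ)‖ := by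
  set g := smulLeftCLM ℂ (inner ℝ · e : E → ℝ) ψ with hg
  set k := smulLeftCLM ℂ (inner ℝ · e : E → ℝ) (∂_{e} ψ)
  have hg_le : ‖toL2 g‖ ≤ R * ‖toL2 ψ‖ := norm_smulLeftCLM_inner_le hψ
  have hk_le : ‖toL2 k‖ ≤ R * ‖toL2 (∂_{e} ψ)‖ :=
    norm_smulLeftCLM_inner_le ((tsupport_lineDerivOp_subset e ψ).trans hψ)
  have hdg : toL2 (∂_{e} g) = toL2 ψ + toL2 k := by
    rw [hg, lineDeriv_smulLeftCLM_inner, real_inner_self_eq_norm_sq, he, one_pow, one_smul, map_add]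
  have hparts : ((‖toL2 ψ‖ : ℂ)) ^ 2 =
      -inner ℂ (toL2 (∂_{e} ψ)) (toL2 g) - inner ℂ (toL2 ψ) (toL2 k) := by
    have h := inner_lineDeriv_right ψ g e
    rw [hdg, inner_add_right, inner_self_eq_norm_sq_to_K] at h
    linear_combination h
  have hsq : ‖toL2 ψ‖ ^ 2 ≤ ‖toL2 ψ‖ * (2 * R * ‖toL2 (∂_{e} ψ)‖) := by
    calc ‖toL2 ψ‖ ^ 2 = ‖((‖toL2 ψ‖ : ℂ)) ^ 2‖ := by simp
      _ ≤ ‖inner ℂ (toL2 (∂_{e} ψ)) (toL2 g)‖ + ‖inner ℂ (toL2 ψ) (toL2 k)‖ := by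
        rw [hparts]
        exact (norm_sub_le _ _).trans_eq (by rw [norm_neg])
      _ ≤ ‖toL2 (∂_{e} ψ)‖ * (R * ‖toL2 ψ‖) +
          ‖toL2 ψ‖ * (R * ‖toL2 (∂_{e} ψ)‖) := by
        gcongr
        · exact (norm_inner_le_norm _ _).trans (by gcongr)
        · exact (norm_inner_le_norm _ _).trans (by gcongr)
      _ = _ := by ring
  rcases (norm_nonneg (toL2 ψ)).eq_or_lt with h0 | h0
  · rw [← h0]
    positivity
  · exact le_of_mul_le_mul_left (by rwa [← sq]) h0

end Schwartz

section TestSpace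

open SchwartzMap LineDeriv Laplacian
open scoped SchwartzMap

variable {E : Type*} [NormedAddCommGroup E]

/-- `C₀^∞(Ω)` as a subspace of the Schwartz space. -/
def testSpace [NormedSpace ℝ E] (Ω : Set E) : Submodule ℂ 𝓢(E, ℂ) where
  carrier := {f | HasCompactSupport f ∧ tsupport f ⊆ Ω}
  zero_mem' := by
    have : ((0 : 𝓢(E, ℂ)) : E → ℂ) = 0 := rfl
    simp [this, HasCompactSupport.zero]
  add_mem' := fun {f g} hf hg =>
    ⟨hf.1.add hg.1, (tsupport_add (f := (f : E → ℂ)) (g := g)).trans (Set.union_subset hf.2 hg.2)⟩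
  smul_mem' := fun c f hf =>
    ⟨hf.1.smul_left (f := fun _ => c), (tsupport_smul_subset_right (fun _ => c) f).trans hf.2⟩

namespace testSpace

section Derivatives

variable [NormedSpace ℝ E] {Ω : Set E}

theorem mem_of_tsupport_subset {f g : 𝓢(E, ℂ)} (hf : f ∈ testSpace Ω)
    (h : tsupport g ⊆ tsupport f) : g ∈ testSpace Ω :=
  ⟨hf.1.of_isClosed_subset (isClosed_tsupport _) h, h.trans hf.2⟩

theorem lineDeriv_mem {f : 𝓢(E, ℂ)} (hf : f ∈ testSpace Ω) (m : E) : ∂_{m} f ∈ testSpace Ω :=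
  mem_of_tsupport_subset hf (tsupport_lineDerivOp_subset m f)

/-- The derivative in the direction `m` on `C₀^∞(Ω)`. -/
noncomputable def der (m : E) : testSpace Ω →ₗ[ℂ] testSpace Ω :=
  (lineDerivOpCLM ℂ 𝓢(E, ℂ) m : 𝓢(E, ℂ) →L[ℂ] 𝓢(E, ℂ)).toLinearMap.restrict
    fun _ hf => lineDeriv_mem hf m

theorem coe_der (m : E) (f : testSpace Ω) : (der m f : 𝓢(E, ℂ)) = ∂_{m} (f : 𝓢(E, ℂ)) := rfl

theorem der_sum {ι : Type*} (s : Finset ι) (c : ι → ℝ) (m : ι → E) (f : testSpace Ω) :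
    der (∑ i ∈ s, c i • m i) f = ∑ i ∈ s, (c i : ℂ) • der (m i) f := by
  ext x
  simp only [coe_der, lineDerivOp_left_sum, lineDerivOp_left_smul, AddSubmonoidClass.coe_finsetSum,
    Submodule.coe_smul, sum_apply, smul_apply, Complex.real_smul, smul_eq_mul]

end Derivatives

variable [InnerProductSpace ℝ E] {Ω : Set E}

theorem contDiff_exp_inner (e : E) (a : ℂ) :
    ContDiff ℝ ∞ fun x : E => Complex.exp (a * inner ℝ x e) :=
  (contDiff_const.mul (Complex.ofRealCLM.contDiff.comp
    (contDiff_id.inner ℝ contDiff_const))).cexp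

/-- Multiplication by the exponential weight `exp (a ⟪x, e⟫)` on `C₀^∞(Ω)`. -/
noncomputable def expMul (e : E) (a : ℂ) : testSpace Ω →ₗ[ℂ] testSpace Ω where
  toFun f := ⟨HasCompactSupport.toSchwartzMap
      (f := fun x => Complex.exp (a * inner ℝ x e) * (f : 𝓢(E, ℂ)) x) f.2.1.mul_left
      ((contDiff_exp_inner e a).mul (f : 𝓢(E, ℂ)).smooth'),
    mem_of_tsupport_subset f.2
      (tsupport_mul_subset_right (f := fun x : E => Complex.exp (a * inner ℝ x e)))⟩
  map_add' f g := by
    ext x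
    exact mul_add _ _ _
  map_smul' c f := by
    ext x
    exact mul_left_comm _ _ _

theorem expMul_apply (e : E) (a : ℂ) (f : testSpace Ω) (x : E) :
    (expMul e a f : 𝓢(E, ℂ)) x = Complex.exp (a * inner ℝ x e) * (f : 𝓢(E, ℂ)) x := rfl

theorem der_expMul (e m : E) (a : ℂ) (f : testSpace Ω) :
    der m (expMul e a f) = expMul e a (der m f + (a * inner ℝ m e) • f) := by
  ext x
  have hinner : HasFDerivAt (fun x : E => inner ℝ x e) ((innerSL ℝ).flip e) x :=
    ((innerSL ℝ).flip e).hasFDerivAt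
  have hexp : HasFDerivAt (fun x : E => Complex.exp (a * inner ℝ x e)) _ x :=
    ((Complex.ofRealCLM.hasFDerivAt.comp x hinner).const_mul a).cexp
  rw [coe_der, lineDerivOp_apply_eq_fderiv, expMul_apply,
    show fderiv ℝ (expMul e a f : 𝓢(E, ℂ)) x = _ from
      (hexp.mul ((f : 𝓢(E, ℂ)).hasFDerivAt x)).fderiv]
  simp [coe_der, lineDerivOp_apply_eq_fderiv, innerSL_apply_apply ℝ e m,
    real_inner_comm e m]
  ring

variable [FiniteDimensional ℝ E]

theorem laplacian_mem {f : 𝓢(E, ℂ)} (hf : f ∈ testSpace Ω) : Δ f ∈ testSpace Ω := by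
  rw [laplacian_eq_sum (stdOrthonormalBasis ℝ E)]
  exact Submodule.sum_mem _ fun i _ => lineDeriv_mem (lineDeriv_mem hf _) _

/-- The Laplacian on `C₀^∞(Ω)`. -/
noncomputable def lap : testSpace Ω →ₗ[ℂ] testSpace Ω :=
  (laplacianCLM ℂ E 𝓢(E, ℂ) : 𝓢(E, ℂ) →L[ℂ] 𝓢(E, ℂ)).toLinearMap.restrict
    fun f hf => by simpa using laplacian_mem hf

theorem coe_lap (f : testSpace Ω) : (lap f : 𝓢(E, ℂ)) = Δ (f : 𝓢(E, ℂ)) :=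
  laplacianCLM_eq ℂ (f : 𝓢(E, ℂ))

theorem lap_eq_sum {ι : Type*} [Fintype ι] (b : OrthonormalBasis ι ℝ E) (f : testSpace Ω) :
    lap f = ∑ i, der (b i) (der (b i) f) :=
  Subtype.ext <| by
    rw [coe_lap, laplacian_eq_sum b, AddSubmonoidClass.coe_finsetSum]
    rfl

theorem lap_expMul {e : E} (he : ‖e‖ = 1) (a : ℂ) (f : testSpace Ω) :
    lap (expMul e a f) = expMul e a (lap f + (2 * a) • der e f + a ^ 2 • f) := by
  set b := stdOrthonormalBasis ℝ E
  have hder : der e f = ∑ i, (inner ℝ (b i) e : ℂ) • der (b i) f := by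
    rw [← der_sum, b.sum_repr' e]
  have hnorm : ∑ i, (inner ℝ (b i) e : ℂ) ^ 2 = 1 := by
    exact_mod_cast (b.sum_sq_inner_right e).trans (by rw [he, one_pow])
  have hterm : ∀ i, der (b i) (der (b i) (expMul e a f)) = expMul e a (der (b i) (der (b i) f) +
      (2 * a) • (inner ℝ (b i) e : ℂ) • der (b i) f + (inner ℝ (b i) e : ℂ) ^ 2 • a ^ 2 • f) := by
    intro i
    rw [der_expMul, der_expMul, map_add (der (b i)), map_smul (der (b i))]
    congr 1
    module
  rw [lap_eq_sum b, lap_eq_sum b, Finset.sum_congr rfl fun i _ => hterm i, ← map_sum, hder,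
    Finset.sum_add_distrib, Finset.sum_add_distrib, Finset.smul_sum, ← Finset.sum_smul, hnorm,
    one_smul]

/-- The coefficients, as polynomials in `a`, of the conjugate of the bilaplacian by
`exp (a ⟪x, e⟫)`, apart from the leading one, which is `1`. -/
noncomputable def conjCoeff (e : E) : Fin 4 → testSpace Ω →ₗ[ℂ] testSpace Ω :=
  ![lap ∘ₗ lap, (2 : ℂ) • (lap ∘ₗ der e + der e ∘ₗ lap),
    (4 : ℂ) • der e ∘ₗ der e + (2 : ℂ) • lap, (4 : ℂ) • der e]

theorem lap_lap_expMul {e : E} (he : ‖e‖ = 1) (a : ℂ) (f : testSpace Ω) :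
    lap (lap (expMul e a f)) - a ^ 4 • expMul e a f =
      expMul e a (∑ j : Fin 4, a ^ (j : ℕ) • conjCoeff e j f) := by
  rw [lap_expMul he, lap_expMul he, ← map_smul (expMul e a) (a ^ 4), ← map_sub (expMul e a)]
  congr 1
  simp only [map_add, map_smul, Fin.sum_univ_four, conjCoeff, Matrix.cons_val, LinearMap.add_apply,
    LinearMap.smul_apply, LinearMap.comp_apply, Fin.val_zero, Fin.val_one, Fin.val_two,
    show ((3 : Fin 4) : ℕ) = 3 from rfl]
  module

variable [MeasurableSpace E] [BorelSpace E]

/-- The inclusion `C₀^∞(Ω) → L²(Ω)`. -/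
noncomputable def incl : testSpace Ω →ₗ[ℂ] Lp ℂ 2 (volume.restrict Ω) :=
  (LpToLpRestrictCLM E ℂ ℂ volume 2 Ω).toLinearMap ∘ₗ toL2 ∘ₗ (testSpace Ω).subtype

theorem coeFn_incl (f : testSpace Ω) : incl f =ᵐ[volume.restrict Ω] (f : 𝓢(E, ℂ)) :=
  (LpToLpRestrictCLM_coeFn ℂ Ω (toL2 (f : 𝓢(E, ℂ)))).trans
    (ae_restrict_of_ae (coeFn_toL2 (f : 𝓢(E, ℂ))))

theorem inner_incl (f g : testSpace Ω) :
    inner ℂ (incl f) (incl g) = inner ℂ (toL2 (f : 𝓢(E, ℂ))) (toL2 (g : 𝓢(E, ℂ))) := by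
  have hcompl : ∀ x, x ∉ Ω → inner ℂ ((f : 𝓢(E, ℂ)) x) ((g : 𝓢(E, ℂ)) x) = 0 := fun x hx => by
    rw [image_eq_zero_of_notMem_tsupport fun h => hx (f.2.2 h), inner_zero_left]
  rw [L2.inner_def, inner_toL2, ← setIntegral_eq_integral_of_forall_compl_eq_zero hcompl]
  refine integral_congr_ae ?_
  filter_upwards [coeFn_incl f, coeFn_incl g] with x hf hg
  rw [hf, hg]

theorem norm_incl (f : testSpace Ω) : ‖incl f‖ = ‖toL2 (f : 𝓢(E, ℂ))‖ := by
  rw [norm_eq_sqrt_re_inner (𝕜 := ℂ), norm_eq_sqrt_re_inner (𝕜 := ℂ), inner_incl]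

theorem incl_injective : Function.Injective (incl : testSpace Ω → Lp ℂ 2 (volume.restrict Ω)) := by
  rw [injective_iff_map_eq_zero]
  intro f hf
  have : toL2 (f : 𝓢(E, ℂ)) = 0 := by rw [← norm_eq_zero, ← norm_incl, hf, norm_zero]
  exact Subtype.ext (SchwartzMap.injective_toLp 2 volume (this.trans (map_zero toL2).symm))

theorem inner_incl_lap (f g : testSpace Ω) :
    inner ℂ (incl (lap f)) (incl g) = inner ℂ (incl f) (incl (lap g)) := by
  rw [inner_incl, inner_incl, coe_lap, coe_lap, inner_laplacian_right]

theorem inner_incl_lap_lap (f g : testSpace Ω) :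
    inner ℂ (incl (lap (lap f))) (incl g) = inner ℂ (incl f) (incl (lap (lap g))) := by
  rw [inner_incl_lap, inner_incl_lap]

theorem norm_incl_expMul_I (e : E) (k : ℝ) (f : testSpace Ω) :
    ‖incl (expMul e (Complex.I * k) f)‖ = ‖incl f‖ := by
  have hexp : ∀ x : E, ‖Complex.exp (Complex.I * k * inner ℝ x e)‖ = 1 := fun x => by
    rw [Complex.norm_exp]
    simp
  have hnorm (x : E) : ‖(expMul e (Complex.I * k) f : 𝓢(E, ℂ)) x‖ = 1 * ‖(f : 𝓢(E, ℂ)) x‖ := by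
    rw [expMul_apply, norm_mul, hexp]
  rw [norm_incl, norm_incl]
  exact le_antisymm ((norm_toL2_le_of_norm_le fun x => (hnorm x).le).trans_eq (one_mul _))
    ((norm_toL2_le_of_norm_le fun x => by rw [hnorm, one_mul, one_mul]).trans_eq (one_mul _))

/-- Carleman's estimate for the Laplacian with a linear weight. -/
theorem mul_norm_expMul_le {e : E} (he : ‖e‖ = 1) {R : ℝ} (hR : 0 ≤ R)
    (hΩ : ∀ x ∈ Ω, |inner ℝ x e| ≤ R) {τ : ℝ} (hτ : 0 ≤ τ) (f : testSpace Ω) :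
    τ * ‖incl (expMul e τ f)‖ ≤ R * ‖incl (expMul e τ (lap f))‖ := by
  set ψ := expMul e τ f with hψ
  have hconj : lap ψ - (2 * τ : ℂ) • der e ψ + ((τ ^ 2 : ℝ) : ℂ) • ψ = expMul e τ (lap f) := by
    rw [hψ, lap_expMul he, der_expMul, real_inner_self_eq_norm_sq, he]
    simp only [map_add, map_smul]
    push_cast
    module
  have hder : 2 * τ * ‖incl (der e ψ)‖ ≤ ‖incl (expMul e τ (lap f))‖ := by
    have h := two_mul_abs_mul_norm_lineDeriv_le τ (τ ^ 2) e (ψ : 𝓢(E, ℂ))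
    rw [abs_of_nonneg hτ] at h
    rwa [← hconj, norm_incl, norm_incl, coe_der, Submodule.coe_add, Submodule.coe_sub,
      Submodule.coe_smul, Submodule.coe_smul, coe_der, coe_lap]
  have hpoincare : ‖incl ψ‖ ≤ 2 * R * ‖incl (der e ψ)‖ := by
    rw [norm_incl, norm_incl]
    exact norm_le_mul_norm_lineDeriv_of_tsupport_subset hR he (ψ.2.2.trans hΩ)
  calc τ * ‖incl ψ‖ ≤ τ * (2 * R * ‖incl (der e ψ)‖) := by gcongr
    _ = R * (2 * τ * ‖incl (der e ψ)‖) := by ring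
    _ ≤ R * ‖incl (expMul e τ (lap f))‖ := by gcongr

theorem sq_mul_norm_expMul_le {e : E} (he : ‖e‖ = 1) {R : ℝ} (hR : 0 ≤ R)
    (hΩ : ∀ x ∈ Ω, |inner ℝ x e| ≤ R) {τ : ℝ} (hτ : 0 ≤ τ) (f : testSpace Ω) :
    τ ^ 2 * ‖incl (expMul e τ f)‖ ≤ R ^ 2 * ‖incl (expMul e τ (lap (lap f)))‖ :=
  calc τ ^ 2 * ‖incl (expMul e τ f)‖ = τ * (τ * ‖incl (expMul e τ f)‖) := by ring
    _ ≤ τ * (R * ‖incl (expMul e τ (lap f))‖) :=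
      mul_le_mul_of_nonneg_left (mul_norm_expMul_le he hR hΩ hτ f) hτ
    _ = R * (τ * ‖incl (expMul e τ (lap f))‖) := by ring
    _ ≤ R * (R * ‖incl (expMul e τ (lap (lap f)))‖) :=
      mul_le_mul_of_nonneg_left (mul_norm_expMul_le he hR hΩ hτ (lap f)) hR
    _ = R ^ 2 * ‖incl (expMul e τ (lap (lap f)))‖ := by ring

theorem norm_incl_lap_le (f : testSpace Ω) :
    ‖incl (lap f)‖ ≤ ‖incl f‖ + ‖incl (lap (lap f))‖ := by
  have hsq : ‖incl (lap f)‖ ^ 2 ≤ ‖incl f‖ * ‖incl (lap (lap f))‖ :=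
    calc ‖incl (lap f)‖ ^ 2 = ‖inner ℂ (incl (lap f)) (incl (lap f))‖ := by
          rw [inner_self_eq_norm_sq_to_K]
          simp
      _ = ‖inner ℂ (incl f) (incl (lap (lap f)))‖ := by rw [inner_incl_lap]
      _ ≤ _ := norm_inner_le_norm _ _
  refine (abs_le_of_sq_le_sq' ?_ (by positivity)).2
  nlinarith [norm_nonneg (incl f), norm_nonneg (incl (lap (lap f)))]

theorem exists_norm_apply_le (hE : Module.finrank ℝ E < 4) : ∃ C, 0 ≤ C ∧
    ∀ (f : testSpace Ω) (x : E),
      ‖(f : 𝓢(E, ℂ)) x‖ ≤ C * (‖incl f‖ + ‖incl (lap (lap f))‖) := by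
  obtain ⟨C, hC, hsup⟩ := exists_norm_apply_le_norm_sub_laplacian hE
  refine ⟨2 * C, by positivity, fun f x => ?_⟩
  calc ‖(f : 𝓢(E, ℂ)) x‖ ≤ C * ‖incl (f - lap f)‖ := by
        rw [norm_incl, Submodule.coe_sub, coe_lap]
        exact hsup f x
    _ ≤ C * (‖incl f‖ + ‖incl (lap f)‖) := by
      gcongr
      rw [map_sub]
      exact norm_sub_le _ _
    _ ≤ C * (‖incl f‖ + (‖incl f‖ + ‖incl (lap (lap f))‖)) := by
      gcongr
      exact norm_incl_lap_le f
    _ ≤ 2 * C * (‖incl f‖ + ‖incl (lap (lap f))‖) := by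
      nlinarith [mul_nonneg hC (norm_nonneg (incl (lap (lap f))))]

end testSpace

end TestSpace

theorem exists_norm_apply_le_of_injective {G F : Type*} [NormedAddCommGroup G] [NormedSpace ℂ G]
    [NormedAddCommGroup F] [NormedSpace ℂ F] {N : ℕ} (A : (Fin N → ℂ) →ₗ[ℂ] G)
    {B : (Fin N → ℂ) →ₗ[ℂ] F} (hB : Function.Injective B) :
    ∃ C, ∀ c, ‖A c‖ ≤ C * ‖B c‖ := by
  obtain ⟨K, -, hK⟩ := B.exists_antilipschitzWith (LinearMap.ker_eq_bot.2 hB)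
  refine ⟨‖A.toContinuousLinearMap‖ * K, fun c => ?_⟩
  have hKc : ‖c‖ ≤ K * ‖B c‖ := by
    simpa only [map_zero, dist_zero_right] using hK.le_mul_dist c 0
  calc ‖A c‖ ≤ ‖A.toContinuousLinearMap‖ * ‖c‖ := A.toContinuousLinearMap.le_opNorm c
    _ ≤ ‖A.toContinuousLinearMap‖ * (K * ‖B c‖) := by gcongr
    _ = _ := (mul_assoc _ _ _).symm

section Domain

open SchwartzMap
open scoped SchwartzMap

variable {E : Type*} [NormedAddCommGroup E] [InnerProductSpace ℝ E] [FiniteDimensional ℝ E]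

section TestFunctions

variable {Ω : Set E}

theorem testSpace.exists_apply_eq_one (hΩ : IsOpen Ω) {x : E} (hx : x ∈ Ω) {s : Set E}
    (hs : s.Finite) (hxs : x ∉ s) :
    ∃ φ : testSpace Ω, (φ : 𝓢(E, ℂ)) x = 1 ∧ ∀ y ∈ s, (φ : 𝓢(E, ℂ)) y = 0 := by
  obtain ⟨f, hf_sub, hf_compact, hf_smooth, -, hfx⟩ := exists_contDiff_tsupport_subset (n := ⊤)
    ((hΩ.sdiff hs.isClosed).mem_nhds ⟨hx, hxs⟩)
  have hsupp : tsupport (fun x => (f x : ℂ)) ⊆ tsupport f :=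
    closure_mono fun x hx h => hx (by simp [h])
  have hcompact : HasCompactSupport fun x => (f x : ℂ) :=
    hf_compact.comp_left (g := fun r : ℝ => (r : ℂ)) rfl
  refine ⟨⟨hcompact.toSchwartzMap (Complex.ofRealCLM.contDiff.comp hf_smooth), hcompact,
    hsupp.trans (hf_sub.trans Set.sdiff_subset)⟩, ?_, fun y hy => ?_⟩
  · change (f x : ℂ) = 1
    rw [hfx, Complex.ofReal_one]
  · change (f y : ℂ) = 0
    rw [image_eq_zero_of_notMem_tsupport fun h => (hf_sub h).2 hy, Complex.ofReal_zero]

theorem testSpace.exists_linearMap_injective [Nontrivial E] (hΩ : IsOpen Ω) (hne : Ω.Nonempty)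
    (N : ℕ) : ∃ ℓ : (Fin N → ℂ) →ₗ[ℂ] testSpace Ω, Function.Injective ℓ := by
  have hinf : Ω.Infinite := by
    obtain ⟨x, hx⟩ := hne
    exact infinite_of_mem_nhds x (hΩ.mem_nhds hx)
  set p : Fin N → E := fun i => hinf.natEmbedding _ i
  have hp : Function.Injective p := fun i j hij =>
    Fin.ext ((hinf.natEmbedding _).injective (Subtype.ext hij))
  have hφ : ∀ i, ∃ φ : testSpace Ω, ∀ j, (φ : 𝓢(E, ℂ)) (p j) = if i = j then 1 else 0 := by
    intro i
    obtain ⟨φ, hφ_one, hφ_zero⟩ := testSpace.exists_apply_eq_one hΩ (hinf.natEmbedding _ i).2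
      (Set.toFinite (p '' {i}ᶜ)) (fun ⟨j, hj, hji⟩ => hj (hp hji))
    refine ⟨φ, fun j => ?_⟩
    split_ifs with h
    · rw [← h]
      exact hφ_one
    · exact hφ_zero _ ⟨j, fun hji => h hji.symm, rfl⟩
  choose φ hφ using hφ
  refine ⟨Fintype.linearCombination ℂ φ, ?_⟩
  rw [injective_iff_map_eq_zero]
  intro c hc
  funext j
  have heval : (Fintype.linearCombination ℂ φ c : 𝓢(E, ℂ)) (p j) = c j := by
    rw [Fintype.linearCombination_apply, Submodule.coe_sum, sum_apply]
    simp [hφ]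
  rw [← heval, hc]
  rfl

end TestFunctions

variable [MeasurableSpace E] [BorelSpace E]

open testSpace

/-- Modulated amplitudes are quasimodes: conjugated by `exp (i k ⟪x, e⟫)`, the bilaplacian is `k⁴`
up to terms of order `k³`. -/
theorem testSpace.exists_norm_incl_lap_lap_sub_le {Ω : Set E} {e : E} (he : ‖e‖ = 1) {N : ℕ}
    {ℓ : (Fin N → ℂ) →ₗ[ℂ] testSpace Ω} (hℓ : Function.Injective ℓ) :
    ∃ C, ∀ k : ℝ, 1 ≤ k → ∀ c,
      ‖incl (lap (lap (expMul e (Complex.I * k) (ℓ c)))) -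
        ((k ^ 4 : ℝ) : ℂ) • incl (expMul e (Complex.I * k) (ℓ c))‖ ≤ C * k ^ 3 * ‖incl (ℓ c)‖ := by
  choose C hle using fun j : Fin 4 =>
    exists_norm_apply_le_of_injective (incl ∘ₗ conjCoeff e j ∘ₗ ℓ)
      (B := incl ∘ₗ ℓ) (incl_injective.comp hℓ)
  refine ⟨∑ j, C j, fun k hk c => ?_⟩
  set a : ℂ := Complex.I * k
  have ha : ‖a‖ = k := by
    rw [norm_mul, Complex.norm_I, one_mul, Complex.norm_real, Real.norm_of_nonneg (by linarith)]
  have ha4 : ((k ^ 4 : ℝ) : ℂ) = a ^ 4 := by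
    rw [mul_pow, Complex.I_pow_four, one_mul, Complex.ofReal_pow]
  calc ‖incl (lap (lap (expMul e a (ℓ c)))) - ((k ^ 4 : ℝ) : ℂ) • incl (expMul e a (ℓ c))‖
      = ‖∑ j : Fin 4, a ^ (j : ℕ) • incl (conjCoeff e j (ℓ c))‖ := by
        rw [ha4, ← map_smul, ← map_sub, lap_lap_expMul he, norm_incl_expMul_I, map_sum]
        simp only [map_smul]
    _ ≤ ∑ j, C j * k ^ 3 * ‖incl (ℓ c)‖ := by
        refine norm_sum_le_of_le _ fun j _ => ?_
        rw [norm_smul, norm_pow, ha, mul_right_comm, mul_comm _ (k ^ 3)]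
        gcongr
        · exact j.is_le
        · exact hle j c
    _ = _ := by rw [← Finset.sum_mul, ← Finset.sum_mul]

/-- The space `H₀^{P₀}(Ω)`, as the domain of the closure in `L²(Ω)` of the bilaplacian on
`C₀^∞(Ω)`. -/
noncomputable abbrev minDomain (Ω : Set E) :
    Submodule ℂ (WithLp 2 (Lp ℂ 2 (volume.restrict Ω) × Lp ℂ 2 (volume.restrict Ω))) :=
  graphClosure (incl ∘ₗ lap ∘ₗ lap : testSpace Ω →ₗ[ℂ] Lp ℂ 2 (volume.restrict Ω)) incl

namespace minDomain

variable {Ω : Set E}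

/-- The closure of the bilaplacian on `C₀^∞(Ω)`. -/
noncomputable abbrev bilap : minDomain Ω →L[ℂ] Lp ℂ 2 (volume.restrict Ω) := graphClosure.op

/-- The inclusion `H₀^{P₀}(Ω) → L²(Ω)`. -/
noncomputable abbrev embed : minDomain Ω →L[ℂ] Lp ℂ 2 (volume.restrict Ω) := graphClosure.incl

/-- A test function as an element of `H₀^{P₀}(Ω)`. -/
noncomputable abbrev ofTest : testSpace Ω →ₗ[ℂ] minDomain Ω := graphClosure.ofCore _ _

theorem inner_bilap_embed (h g : minDomain Ω) :
    inner ℂ (bilap h) (embed g) = inner ℂ (embed h) (bilap g) :=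
  graphClosure.inner_op_incl inner_incl_lap_lap h g

theorem isCompactOperator_embed (hE : Module.finrank ℝ E < 4) (hΩ : volume Ω ≠ ⊤) :
    IsCompactOperator (embed : minDomain Ω →L[ℂ] _) := by
  obtain ⟨C, hC, hsup⟩ := exists_norm_apply_le (Ω := Ω) hE
  have : IsFiniteMeasure (volume.restrict Ω) := isFiniteMeasure_restrict.2 hΩ
  refine isCompactOperator_of_ae_norm_le (memLp_const (2 * C))
    (ae_norm_le_mul_norm_of_denseRange graphClosure.denseRange_ofCore fun f => ?_)
  filter_upwards [coeFn_incl f] with x hx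
  rw [graphClosure.incl_ofCore, hx]
  calc ‖(f : 𝓢(E, ℂ)) x‖ ≤ C * (‖incl f‖ + ‖incl (lap (lap f))‖) := hsup f x
    _ ≤ C * (‖ofTest f‖ + ‖ofTest f‖) := by
      gcongr
      · exact graphClosure.norm_incl_le (ofTest f)
      · exact graphClosure.norm_op_le (ofTest f)
    _ = 2 * C * ‖ofTest f‖ := by ring

theorem exists_ge_negIndexGE_pencil (hΩ : IsOpen Ω) (hne : Ω.Nonempty) {e : E} (he : ‖e‖ = 1)
    {W : Lp ℂ 2 (volume.restrict Ω) →L[ℂ] Lp ℂ 2 (volume.restrict Ω)} {δ : ℝ} (hδ : 0 < δ)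
    (hW : ∀ u, (inner ℂ (W u) u).re ≤ δ⁻¹ * ‖u‖ ^ 2) (t₀ : ℝ) (N : ℕ) :
    ∃ t ≥ t₀, NegIndexGE N (pencil (bilap : minDomain Ω →L[ℂ] _) embed W t) := by
  have : Nontrivial E := ⟨e, 0, fun h => by simp [h] at he⟩
  obtain ⟨ℓ, hℓ⟩ := testSpace.exists_linearMap_injective hΩ hne N
  obtain ⟨C, hquasi⟩ := exists_norm_incl_lap_lap_sub_le he hℓ
  set s := 1 + δ / 2
  have hs : 0 < s := by positivity
  obtain ⟨k, hk_one, hk_t₀, hk_C⟩ : ∃ k : ℝ, 1 ≤ k ∧ t₀ * s ≤ k ∧ 16 * C * s / δ ≤ k :=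
    ((eventually_ge_atTop 1).and ((eventually_ge_atTop _).and (eventually_ge_atTop _))).exists
  have hk : 0 < k := by linarith
  have hts : k ^ 4 / s * s = k ^ 4 := div_mul_cancel₀ _ hs.ne'
  refine ⟨k ^ 4 / s, ?_, ofTest ∘ₗ expMul e (Complex.I * k) ∘ₗ ℓ, fun c hc => ?_⟩
  · rw [ge_iff_le, le_div_iff₀ hs]
    exact hk_t₀.trans (le_self_pow₀ hk_one four_ne_zero)
  have hnorm := norm_incl_expMul_I e k (ℓ c)
  refine re_inner_pencil_neg hδ (by positivity) hW ?_ ?_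
  · rw [← norm_pos_iff]
    change 0 < ‖incl (expMul e (Complex.I * k) (ℓ c))‖
    rw [hnorm, norm_pos_iff, ne_eq, map_eq_zero_iff _ incl_injective, map_eq_zero_iff _ hℓ]
    exact hc
  · change ‖incl (lap (lap (expMul e (Complex.I * k) (ℓ c)))) - ((k ^ 4 / s * s : ℝ) : ℂ) •
      incl (expMul e (Complex.I * k) (ℓ c))‖ ≤
        δ / 16 * (k ^ 4 / s) * ‖incl (expMul e (Complex.I * k) (ℓ c))‖
    rw [hts, hnorm]
    refine (hquasi k hk_one c).trans (mul_le_mul_of_nonneg_right ?_ (norm_nonneg _))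
    rw [mul_div_assoc', le_div_iff₀ hs]
    rw [div_le_iff₀ hδ] at hk_C
    nlinarith [pow_pos hk 3]

section UniqueContinuation

variable {e : E} {R : ℝ}

theorem memLp_exp_inner (hΩR : ∀ x ∈ Ω, |inner ℝ x e| ≤ R)
    (hΩ : MeasurableSet Ω) (τ : ℝ) :
    MemLp (fun x : E => Real.exp (τ * inner ℝ x e)) ⊤ (volume.restrict Ω) := by
  refine memLp_top_of_bound (C := Real.exp (|τ| * R)) (by fun_prop) ?_
  filter_upwards [ae_restrict_mem hΩ] with x hx
  rw [Real.norm_eq_abs, Real.abs_exp, Real.exp_le_exp]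
  calc τ * inner ℝ x e ≤ |τ| * |inner ℝ x e| := (le_abs_self _).trans_eq (abs_mul _ _)
    _ ≤ |τ| * R := by
      gcongr
      exact hΩR x hx

theorem mulOp_incl {τ : ℝ}
    (hb : MemLp (fun x : E => Real.exp (τ * inner ℝ x e)) ⊤ (volume.restrict Ω)) (f : testSpace Ω) :
    mulOp _ hb (incl f) = incl (expMul e τ f) := by
  refine Lp.ext ?_
  filter_upwards [coeFn_mulOp hb (incl f), coeFn_incl f, coeFn_incl (expMul e τ f)] with x hX hf hτf
  rw [hX, hf, hτf, expMul_apply]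
  push_cast
  rfl

theorem sq_mul_norm_mulOp_embed_le (hΩR : ∀ x ∈ Ω, |inner ℝ x e| ≤ R)
    (he : ‖e‖ = 1) (hR : 0 ≤ R) {τ : ℝ} (hτ : 0 ≤ τ)
    (hb : MemLp (fun x : E => Real.exp (τ * inner ℝ x e)) ⊤ (volume.restrict Ω))
    (h : minDomain Ω) :
    τ ^ 2 * ‖mulOp _ hb (embed h)‖ ≤ R ^ 2 * ‖mulOp _ hb (bilap h)‖ := by
  refine graphClosure.denseRange_ofCore.induction_on
    (p := fun h => τ ^ 2 * ‖mulOp _ hb (embed h)‖ ≤ R ^ 2 * ‖mulOp _ hb (bilap h)‖) h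
    (isClosed_le (by fun_prop) (by fun_prop)) fun f => ?_
  rw [graphClosure.op_ofCore, graphClosure.incl_ofCore, LinearMap.comp_apply, LinearMap.comp_apply,
    mulOp_incl, mulOp_incl]
  exact sq_mul_norm_expMul_le he hR hΩR hτ f

/-- Unique continuation from the exterior: the bound contradicts Carleman's estimate with a large
parameter unless `h = 0`. -/
theorem eq_zero_of_ae_norm_bilap_le (hΩR : ∀ x ∈ Ω, |inner ℝ x e| ≤ R)
    (hΩ : MeasurableSet Ω) (he : ‖e‖ = 1) (hR : 0 ≤ R) {q : ℝ} (hq : 0 ≤ q) {h : minDomain Ω}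
    (hle : ∀ᵐ x ∂volume.restrict Ω, ‖bilap h x‖ ≤ q * ‖embed h x‖) : h = 0 := by
  set τ := √(R ^ 2 * q + 1)
  have hτ : τ ^ 2 = R ^ 2 * q + 1 := Real.sq_sqrt (by positivity)
  have hb := memLp_exp_inner hΩR hΩ τ
  have hcarleman := sq_mul_norm_mulOp_embed_le hΩR he hR (Real.sqrt_nonneg _) hb h
  have hweighted : ‖mulOp _ hb (bilap h)‖ ≤ q * ‖mulOp _ hb (embed h)‖ :=
    norm_mulOp_le_of_ae_norm_le hb hle
  have hXh : mulOp _ hb (embed h) = 0 := by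
    rw [hτ] at hcarleman
    rw [← norm_le_zero_iff]
    linarith [mul_le_mul_of_nonneg_left hweighted (sq_nonneg R)]
  have hh : embed h = 0 := (map_eq_zero_iff _
    (mulOp_injective hb (ae_of_all _ fun x => (Real.exp_pos _).ne'))).1 hXh
  have hnorm : ‖bilap h‖ ≤ 0 := by
    simpa only [hh, norm_zero, mul_zero] using Lp.norm_le_mul_norm_of_ae_le_mul hle
  rw [← norm_eq_zero, ← sq_eq_zero_iff, graphClosure.norm_sq_eq, hh, norm_zero,
    le_antisymm hnorm (norm_nonneg _)]
  norm_num

end UniqueContinuation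

end minDomain

end Domain

section TransmissionEigenvalue

open SchwartzMap testSpace minDomain
open scoped SchwartzMap

section Pointwise

variable {α H : Type*} [MeasurableSpace α] {μ : Measure α}
variable [NormedAddCommGroup H] [InnerProductSpace ℂ H] (A J : H →L[ℂ] Lp ℂ 2 μ)
variable {V : α → ℝ} {t : ℝ}

theorem ae_apply_eq_transmitted (hV : MemLp V⁻¹ ⊤ μ) (hV₀ : ∀ᵐ x ∂μ, V x ≠ 0) (ht : t ≠ 0)
    (h : H) :
    ∀ᵐ x ∂μ, A h x = t * (J h x - V x * transmitted A J (mulOp _ hV) t h x) := by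
  filter_upwards [hV₀, Lp.coeFn_sub (A h) ((t : ℂ) • J h), Lp.coeFn_smul (t : ℂ) (J h),
    coeFn_mulOp hV (shift A J t h),
    Lp.coeFn_smul (-(t : ℂ)⁻¹) (mulOp _ hV (shift A J t h))] with x hVx hsub hsmul hmul htr
  have htc : (t : ℂ) ≠ 0 := by exact_mod_cast ht
  have hVc : (V x : ℂ) ≠ 0 := by exact_mod_cast hVx
  rw [transmitted, htr, Pi.smul_apply, hmul, shift_apply, hsub, Pi.sub_apply, hsmul, Pi.smul_apply,
    smul_eq_mul, smul_eq_mul, Pi.inv_apply, Complex.ofReal_inv]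
  field_simp
  ring

theorem ae_smul_sub_eq_transmitted (hV : MemLp V⁻¹ ⊤ μ) (hV₀ : ∀ᵐ x ∂μ, V x ≠ 0) (ht : t ≠ 0)
    (h : H) :
    ∀ᵐ x ∂μ, ((t : ℂ) • (J h + transmitted A J (mulOp _ hV) t h) - A h : Lp ℂ 2 μ) x =
      t * (1 + V x) * transmitted A J (mulOp _ hV) t h x := by
  set w := transmitted A J (mulOp _ hV) t h
  filter_upwards [ae_apply_eq_transmitted A J hV hV₀ ht h, Lp.coeFn_sub ((t : ℂ) • (J h + w)) (A h),
    Lp.coeFn_smul (t : ℂ) (J h + w), Lp.coeFn_add (J h) w] with x hx hsub hsmul hadd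
  rw [hsub, Pi.sub_apply, hsmul, Pi.smul_apply, hadd, Pi.add_apply, hx, smul_eq_mul]
  ring

end Pointwise

section Nonvanishing

variable {E : Type*} [NormedAddCommGroup E] [InnerProductSpace ℝ E] [FiniteDimensional ℝ E]
variable [MeasurableSpace E] [BorelSpace E] {Ω : Set E} {e : E} {R : ℝ}
variable {V : E → ℝ} {t : ℝ} {h : minDomain Ω}

theorem transmitted_ne_zero (hΩR : ∀ x ∈ Ω, |inner ℝ x e| ≤ R) (hΩ : MeasurableSet Ω)
    (he : ‖e‖ = 1) (hR : 0 ≤ R) (hV : MemLp V⁻¹ ⊤ (volume.restrict Ω))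
    (hV₀ : ∀ᵐ x ∂volume.restrict Ω, V x ≠ 0) (ht : 0 < t) (hh : h ≠ 0) :
    transmitted bilap embed (mulOp _ hV) t h ≠ 0 := by
  intro hw
  refine hh (eq_zero_of_ae_norm_bilap_le hΩR hΩ he hR ht.le ?_)
  filter_upwards [ae_apply_eq_transmitted bilap embed hV hV₀ ht.ne' h,
    (Lp.eq_zero_iff_ae_eq_zero).1 hw] with x hx hwx
  rw [hx, hwx, Pi.zero_apply, mul_zero, sub_zero, norm_mul, Complex.norm_real,
    Real.norm_of_nonneg ht.le]

theorem add_transmitted_ne_zero (hΩR : ∀ x ∈ Ω, |inner ℝ x e| ≤ R) (hΩ : MeasurableSet Ω)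
    (he : ‖e‖ = 1) (hR : 0 ≤ R) (hV : MemLp V⁻¹ ⊤ (volume.restrict Ω))
    (hV₀ : ∀ᵐ x ∂volume.restrict Ω, V x ≠ 0) {M : ℝ} (hM : 0 ≤ M)
    (hVM : ∀ᵐ x ∂volume.restrict Ω, |V x| ≤ M) (ht : 0 < t) (hh : h ≠ 0) :
    embed h + transmitted bilap embed (mulOp _ hV) t h ≠ 0 := by
  intro hv
  refine hh (eq_zero_of_ae_norm_bilap_le hΩR hΩ he hR (q := t * (1 + M)) (by positivity) ?_)
  filter_upwards [ae_apply_eq_transmitted bilap embed hV hV₀ ht.ne' h, hVM,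
    Lp.coeFn_neg (embed h)] with x hx hVx hneg
  calc ‖bilap h x‖ = ‖(t : ℂ) * (1 + V x) * embed h x‖ := by
        rw [hx, eq_neg_of_add_eq_zero_right hv, hneg, Pi.neg_apply]
        congr 1
        ring
    _ = t * ‖(1 + V x : ℂ)‖ * ‖embed h x‖ := by
        rw [norm_mul, norm_mul, Complex.norm_real, Real.norm_of_nonneg ht.le]
    _ ≤ t * (1 + M) * ‖embed h x‖ := by
        gcongr
        calc ‖(1 + V x : ℂ)‖ ≤ ‖(1 : ℂ)‖ + ‖(V x : ℂ)‖ := norm_add_le _ _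
          _ ≤ 1 + M := by
            rw [norm_one, Complex.norm_real, Real.norm_eq_abs]
            gcongr

end Nonvanishing

variable {Ω : Set R3}

theorem testSpace.bilaplacian_eq (f : testSpace Ω) :
    bilaplacian (f : 𝓢(R3, ℂ)) = (lap (lap f) : 𝓢(R3, ℂ)) := by
  have hlap : ∀ g : testSpace Ω, (Laplacian.laplacian ((g : 𝓢(R3, ℂ)) : R3 → ℂ) : R3 → ℂ) =
      (lap g : 𝓢(R3, ℂ)) := fun g => by
    funext x
    rw [coe_lap, laplacian_apply]
  rw [bilaplacian, hlap, hlap]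

theorem testSpace.isTestFunction (f : testSpace Ω) : IsTestFunction Ω (f : 𝓢(R3, ℂ)) :=
  ⟨(f : 𝓢(R3, ℂ)).smooth', f.2.1, f.2.2⟩

theorem testSpace.normP_eq (f : testSpace Ω) :
    normP (f : 𝓢(R3, ℂ)) = ‖incl (lap (lap f))‖ₑ := by
  rw [normP, bilaplacian_eq, ← ofReal_norm, norm_incl, ofReal_norm, Lp.enorm_def]
  exact eLpNorm_congr_ae (coeFn_toL2 _).symm

theorem bilaplacian_conj (φ : R3 → ℂ) :
    bilaplacian (Complex.conjCLE ∘ φ) = Complex.conjCLE ∘ bilaplacian φ := by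
  rw [bilaplacian, bilaplacian, InnerProductSpace.laplacian_CLE_comp_left,
    InnerProductSpace.laplacian_CLE_comp_left]

theorem IsTestFunction.conj {φ : R3 → ℂ} (hφ : IsTestFunction Ω φ) :
    IsTestFunction Ω (Complex.conjCLE ∘ φ) where
  smooth := Complex.conjCLE.contDiff.comp hφ.smooth
  compact := hφ.compact.comp_left (map_zero _)
  subset := (tsupport_comp_subset (map_zero Complex.conjCLE) φ).trans hφ.subset

theorem IsTestFunction.exists_eq_conj {φ : R3 → ℂ} (hφ : IsTestFunction Ω φ) :
    ∃ f : testSpace Ω, φ = Complex.conjCLE ∘ (f : 𝓢(R3, ℂ)) :=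
  ⟨⟨hφ.conj.compact.toSchwartzMap hφ.conj.smooth, hφ.conj.compact, hφ.conj.subset⟩,
    funext fun x => (Complex.conj_conj (φ x)).symm⟩

theorem solvesWeakly_of_inner_eq {q : R3 → ℂ} {u F : Lp ℂ 2 (volume.restrict Ω)}
    (hF : ∀ᵐ x ∂volume.restrict Ω, F x = q x * u x)
    (hu : ∀ f : testSpace Ω, inner ℂ (incl (lap (lap f))) u = inner ℂ (incl f) F) :
    SolvesWeakly Ω q u := by
  intro φ hφ
  obtain ⟨f, rfl⟩ := hφ.exists_eq_conj
  calc ∫ x in Ω, u x * (bilaplacian (Complex.conjCLE ∘ (f : 𝓢(R3, ℂ))) x -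
        q x * (Complex.conjCLE ∘ (f : 𝓢(R3, ℂ))) x)
      = ∫ x in Ω, (inner ℂ (incl (lap (lap f)) x) (u x) - inner ℂ (incl f x) (F x)) := by
        refine integral_congr_ae ?_
        filter_upwards [hF, coeFn_incl f, coeFn_incl (lap (lap f))] with x hFx hf hlap
        rw [hFx, hf, hlap, bilaplacian_conj, bilaplacian_eq, RCLike.inner_apply, RCLike.inner_apply]
        simp only [Function.comp_apply, Complex.conjCLE_apply]
        ring
    _ = inner ℂ (incl (lap (lap f))) u - inner ℂ (incl f) F := by
        rw [integral_sub (L2.integrable_inner _ _) (L2.integrable_inner _ _), L2.inner_def,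
          L2.inner_def]
    _ = 0 := sub_eq_zero.2 (hu f)

theorem minDomain.memH0 {h : minDomain Ω} {u : R3 → ℂ} (hu : embed h =ᵐ[volume.restrict Ω] u) :
    MemH0 Ω u := by
  refine ⟨(memLp_congr_ae hu).1 (Lp.memLp _), ?_⟩
  obtain ⟨s, hs, hsh⟩ := mem_closure_iff_seq_limit.1 (graphClosure.denseRange_ofCore h)
  choose f hf using hs
  obtain rfl : (fun j => ofTest (f j)) = s := funext hf
  refine ⟨fun j => (f j : 𝓢(R3, ℂ)), fun j => isTestFunction _, fun η hη => ?_, ?_⟩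
  · have hcauchy : CauchySeq fun j => incl (lap (lap (f j))) :=
      ((bilap.continuous.tendsto h).comp hsh).cauchySeq
    obtain ⟨N, hN⟩ := EMetric.cauchySeq_iff.1 hcauchy η hη
    refine ⟨N, fun j hj k hk => ?_⟩
    calc normP (((f j : 𝓢(R3, ℂ)) : R3 → ℂ) - (f k : 𝓢(R3, ℂ)))
        = ‖incl (lap (lap (f j - f k)))‖ₑ := normP_eq (f j - f k)
      _ = edist (incl (lap (lap (f j)))) (incl (lap (lap (f k)))) := by
        rw [edist_eq_enorm_sub, map_sub, map_sub, map_sub]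
      _ < η := hN j hj k hk
  · have hlim : Tendsto (fun j => incl (f j)) atTop (𝓝 (embed h)) :=
      (embed.continuous.tendsto h).comp hsh
    rw [Lp.tendsto_Lp_iff_tendsto_eLpNorm'] at hlim
    exact hlim.congr fun j => eLpNorm_congr_ae ((coeFn_incl (f j)).sub hu)

theorem solvesWeakly_add_transmitted
    {W : Lp ℂ 2 (volume.restrict Ω) →L[ℂ] Lp ℂ 2 (volume.restrict Ω)} {t : ℝ} {h : minDomain Ω}
    (ht : t ≠ 0) (hker : pencil bilap embed W t h = 0) :
    SolvesWeakly Ω (fun _ => t) ⇑(embed h + transmitted bilap embed W t h) :=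
  solvesWeakly_of_inner_eq (Lp.coeFn_smul (t : ℂ) _)
    fun f => inner_apply_add_transmitted inner_bilap_embed ht hker (ofTest f)

theorem solvesWeakly_transmitted {V : R3 → ℝ} (hV : MemLp V⁻¹ ⊤ (volume.restrict Ω))
    (hV₀ : ∀ᵐ x ∂volume.restrict Ω, V x ≠ 0) {t : ℝ} {h : minDomain Ω} (ht : t ≠ 0)
    (hker : pencil bilap embed (mulOp _ hV) t h = 0) :
    SolvesWeakly Ω (fun x => t * (1 + V x)) ⇑(transmitted bilap embed (mulOp _ hV) t h) := by
  refine solvesWeakly_of_inner_eq (F := (t : ℂ) • (embed h + _) - bilap h) ?_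
    fun f => inner_apply_transmitted ht hker (ofTest f)
  exact ae_smul_sub_eq_transmitted bilap embed hV hV₀ ht h

theorem isTransmissionEigenvalue_of_pencil_eq_zero {e : R3} {R : ℝ}
    (hΩR : ∀ x ∈ Ω, |inner ℝ x e| ≤ R) (hΩ : MeasurableSet Ω) (he : ‖e‖ = 1) (hR : 0 ≤ R)
    {V : R3 → ℝ} (hV : MemLp V⁻¹ ⊤ (volume.restrict Ω))
    (hV₀ : ∀ᵐ x ∂volume.restrict Ω, V x ≠ 0) {M : ℝ} (hM : 0 ≤ M)
    (hVM : ∀ᵐ x ∂volume.restrict Ω, |V x| ≤ M) {t : ℝ} (ht : 0 < t) {h : minDomain Ω} (hh : h ≠ 0)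
    (hker : pencil bilap embed (mulOp _ hV) t h = 0) : IsTransmissionEigenvalue Ω V t := by
  have hloc : ∀ u : Lp ℂ 2 (volume.restrict Ω), MemL2Loc Ω u := fun u K _ hK =>
    (Lp.memLp u).mono_measure (Measure.restrict_mono_set _ hK)
  refine ⟨⇑(embed h + transmitted bilap embed (mulOp _ hV) t h),
    ⇑(transmitted bilap embed (mulOp _ hV) t h), hloc _, hloc _, ?_, ?_,
    solvesWeakly_add_transmitted ht.ne' hker, solvesWeakly_transmitted hV hV₀ ht.ne' hker,
    memH0 (h := h) ?_⟩
  · rw [← Lp.eq_zero_iff_ae_eq_zero]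
    exact add_transmitted_ne_zero hΩR hΩ he hR hV hV₀ hM hVM ht hh
  · rw [← Lp.eq_zero_iff_ae_eq_zero]
    exact transmitted_ne_zero hΩR hΩ he hR hV hV₀ ht hh
  · refine EventuallyEq.trans ?_ (Lp.coeFn_sub _ _)
    rw [add_sub_cancel_right]

end TransmissionEigenvalue

end Biharmonic

open Biharmonic in
theorem proposition7p1_general {Ω : Set R3} (hΩ : IsOpen Ω) (hne : Ω.Nonempty)
    (hΩ_vol : volume Ω ≠ ⊤) {e : R3} (he : ‖e‖ = 1) {R : ℝ} (hΩR : ∀ x ∈ Ω, |inner ℝ x e| ≤ R)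
    {V : R3 → ℝ} (hV : MemLp V ⊤ (volume.restrict Ω)) {δ : ℝ} (hδ : 0 < δ)
    (hVδ : ∀ᵐ x ∂volume.restrict Ω, δ ≤ V x) :
    ¬ BddAbove {lam : ℝ | IsTransmissionEigenvalue Ω V lam} := by
  have hR : 0 ≤ R := (abs_nonneg _).trans (hΩR _ hne.some_mem)
  have hVinv := memLp_top_inv hV.1 hδ hVδ
  have hV₀ : ∀ᵐ x ∂volume.restrict Ω, V x ≠ 0 := hVδ.mono fun x hx => (hδ.trans_le hx).ne'
  obtain ⟨M, hM, hVM⟩ : ∃ M, 0 < M ∧ ∀ᵐ x ∂volume.restrict Ω, |V x| ≤ M := by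
    obtain ⟨C, hC⟩ := exists_ae_norm_le hV
    exact ⟨max C 1, by positivity, hC.mono fun x hx => hx.trans (le_max_left _ _)⟩
  have hlower : ∀ᵐ x ∂volume.restrict Ω, M⁻¹ ≤ V⁻¹ x := by
    filter_upwards [hVδ, hVM] with x hx hxM
    exact inv_anti₀ (hδ.trans_le hx) ((le_abs_self _).trans hxM)
  have hupper : ∀ᵐ x ∂volume.restrict Ω, V⁻¹ x ≤ δ⁻¹ := hVδ.mono fun x hx => inv_anti₀ hδ hx
  rintro ⟨B, hB⟩
  obtain ⟨t, ht, h, hh, hker⟩ := exists_ge_apply_eq_zero (t₀ := max B 0 + 1)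
    (minDomain.isCompactOperator_embed (by simp) hΩ_vol)
    (continuous_pencil minDomain.bilap minDomain.embed (mulOp _ hVinv)).continuousOn
    (fun t _ => isSelfAdjoint_pencil minDomain.inner_bilap_embed (inner_mulOp_comm hVinv) t)
    (fun t _ => satisfiesGarding_pencil (inv_pos.2 hM) (le_re_inner_mulOp hVinv hlower)
      graphClosure.norm_sq_eq t)
    (minDomain.exists_ge_negIndexGE_pencil hΩ hne he hδ (re_inner_mulOp_le hVinv hupper) _)
  have htB := hB (isTransmissionEigenvalue_of_pencil_eq_zero hΩR hΩ.measurableSet he hR hVinv hV₀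
    hM.le hVM (by linarith [le_max_right B 0]) hh hker)
  linarith [le_max_left B 0]

theorem proposition7p1
    (Ω : Set Biharmonic.R3) (hΩ_open : IsOpen Ω) (hΩ_conn : IsConnected Ω)
    (hΩ_bdd : Bornology.IsBounded Ω)
    (V : Biharmonic.R3 → ℝ) (hV : MemLp V ⊤ volume)
    (hV_supp : Biharmonic.essSupport V = closure Ω)
    (δ : ℝ) (hδ : 0 < δ) (hV_lower : ∀ᵐ x ∂(volume.restrict (closure Ω)), δ ≤ V x) :
    {lam : ℝ | Biharmonic.IsTransmissionEigenvalue Ω V (lam : ℂ)}.Infinite := by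
  have he : ‖(EuclideanSpace.single 0 1 : Biharmonic.R3)‖ = 1 := by simp
  obtain ⟨R, hR⟩ := hΩ_bdd.exists_norm_le
  exact Set.infinite_of_not_bddAbove (proposition7p1_general hΩ_open hΩ_conn.nonempty
    hΩ_bdd.measure_lt_top.ne he (fun x hx => (abs_real_inner_le_norm x _).trans
      (by rw [he, mul_one]; exact hR x hx)) (hV.restrict _) hδ
    (ae_restrict_of_ae_restrict_of_subset subset_closure hV_lower))
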